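/- Let $\mathbb{T}^3=\mathbb{R}^3/(2\pi\mathbb{Z})^3$, and let $\dot H^\infty_{\mathrm{div}}$ be the space of smooth (i.e. $H^\infty$) real vector fields $U:\mathbb{T}^3\to\mathbb{R}^3$ with $\int_{\mathbb{T}^3}U=0$ and $\nabla\cdot U=0$, with the metric $$d_{H^\infty}(U,V)=\sum_{n\ge 0}2^{-n}\,\frac{\|U-V\|_{H^n}}{1+\|U-V\|_{H^n}} ,\qquad \|U\|_{H^n}^2=\sum_{|\alpha|\le n}\|\partial^\alpha U\|_{L^2(\mathbb{T}^3)}^2 .$$ For $U\in\dot H^\infty_{\mathrm{div}}$ with $\|\nabla U\|_{L^\infty}<1$ (the supremum over $x$ of the Euclidean operator norm of $\nabla U(x)$), let $\mathcal{S}:\mathbb{C}^3\to L^2(\mathbb{T}^3;\mathbb{C}^3)$ be the solution map which sends $v$ to the unique solution $S=\mathcal{S}(v)$, in the sense of distributions, of $$\nabla\times(U\times S)+\Delta S=\nabla\times(v\times U),\qquad \int_{\mathbb{T}^3}S(x)\,dx=0 ,$$ and for $j\in\mathbb{R}^3\setminus\{0\}$ let $A(U,j)\in\mathbb{C}^{3\times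 3}$ be the matrix with $$A(U,j)\,v=i\,\frac{j}{|j|}\times\frac{1}{|\mathbb{T}^3|}\int_{\mathbb{T}^3}U\times\mathcal{S}(v)\,dx\qquad(v\in\mathbb{C}^3).$$ Let $\Omega$ be the set of all $U\in\dot H^\infty_{\mathrm{div}}$ for which there exist $\delta_0>0$ with $\|\nabla(\delta_0U)\|_{L^\infty}<1$ and $j\in\mathbb{R}^3\setminus\{0\}$ such that $A(\delta_0U,j)$ has a simple eigenvalue $p$ (algebraic multiplicity one) with $\operatorname{Re}p>0$. Then $\Omega$ is open and dense in $(\dot H^\infty_{\mathrm{div}},d_{H^\infty})$. -/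

import Mathlib

open MeasureTheory Set
open scoped Matrix ContDiff ENNReal

namespace AlphaDynamo

/-- The Euclidean space `ℝ³`. The torus `𝕋³` is `ℝ³ / (2πℤ)³`: fields on it are fields on `ℝ³`
that are `2π`-periodic in each coordinate. -/
abbrev E3 : Type := EuclideanSpace ℝ (Fin 3)

/-- `2π`-periodicity in each of the three coordinate directions. -/
def IsPeriodic {F : Type*} (f : E3 → F) : Prop :=
  ∀ (i : Fin 3) (x : E3), f (x + EuclideanSpace.single i (2 * Real.pi)) = f x

/-- The fundamental cell `[0, 2π)³`. -/
def cell : Set E3 := {x | ∀ i, x i ∈ Ico (0 : ℝ) (2 * Real.pi)}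

/-- The `i`-th partial derivative. -/
noncomputable def pd {F : Type*} [NormedAddCommGroup F] [NormedSpace ℝ F]
    (i : Fin 3) (f : E3 → F) : E3 → F :=
  fun x => fderiv ℝ f x (EuclideanSpace.single i 1)

/-- The mixed partial derivative `∂^α = ∂₀^(α 0) ∂₁^(α 1) ∂₂^(α 2)`. -/
noncomputable def pdMulti {F : Type*} [NormedAddCommGroup F] [NormedSpace ℝ F]
    (α : Fin 3 → ℕ) (f : E3 → F) : E3 → F :=
  (pd 0)^[α 0] ((pd 1)^[α 1] ((pd 2)^[α 2] f))

/-- The divergence of a real vector field. -/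
noncomputable def divergence (U : E3 → E3) (x : E3) : ℝ := ∑ i, pd i U x i

/-- The curl of a complex vector field. -/
noncomputable def curl (φ : E3 → Fin 3 → ℂ) (x : E3) : Fin 3 → ℂ :=
  ![pd 1 φ x 2 - pd 2 φ x 1, pd 2 φ x 0 - pd 0 φ x 2, pd 0 φ x 1 - pd 1 φ x 0]

/-- The (componentwise) Laplacian of a complex vector field. -/
noncomputable def vecLaplacian (φ : E3 → Fin 3 → ℂ) (x : E3) : Fin 3 → ℂ :=
  ∑ i, pd i (pd i φ) x

/-- A real vector, seen in `ℂ³`. -/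
def cplx (u : E3) : Fin 3 → ℂ := fun i => ((u i : ℝ) : ℂ)

/-! ### The space of smooth mean-free divergence-free fields and its metric -/

lemma isBounded_cell : Bornology.IsBounded cell := by
  have h : cell ⊆ (EuclideanSpace.equiv (Fin 3) ℝ) ⁻¹'
      (Set.pi univ fun _ => Icc (0 : ℝ) (2 * Real.pi)) := by
    intro x hx i _
    exact ⟨(hx i).1, (hx i).2.le⟩
  have hc : IsCompact ((EuclideanSpace.equiv (Fin 3) ℝ) ⁻¹'
      (Set.pi univ fun _ => Icc (0 : ℝ) (2 * Real.pi))) :=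
    (EuclideanSpace.equiv (Fin 3) ℝ).toHomeomorph.isCompact_preimage.2
      (isCompact_univ_pi fun _ => isCompact_Icc)
  exact hc.isBounded.subset h

instance isFiniteMeasure_cell : IsFiniteMeasure (volume.restrict cell) :=
  ⟨by rw [Measure.restrict_apply_univ]; exact isBounded_cell.measure_lt_top⟩

lemma memLp_of_continuous {f : E3 → E3} (hf : Continuous f) (p : ℝ≥0∞) :
    MemLp f p (volume.restrict cell) := by
  have hK : IsCompact (closure cell) := isBounded_cell.isCompact_closure
  obtain ⟨C, hC⟩ := hK.exists_bound_of_continuousOn hf.continuousOn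
  refine MemLp.of_bound hf.aestronglyMeasurable C ?_
  have : ∀ᵐ x ∂(volume.restrict (closure cell)), ‖f x‖ ≤ C :=
    ae_restrict_of_forall_mem isClosed_closure.measurableSet hC
  exact ae_restrict_of_ae_restrict_of_subset subset_closure this

lemma contDiff_pd {f : E3 → E3} (hf : ContDiff ℝ ∞ f) (i : Fin 3) :
    ContDiff ℝ ∞ (pd i f) :=
  (hf.fderiv_right (m := ∞) (by simp)).clm_apply contDiff_const

lemma pd_add {f g : E3 → E3} (hf : ContDiff ℝ ∞ f) (hg : ContDiff ℝ ∞ g) (i : Fin 3) :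
    pd i (f + g) = pd i f + pd i g := by
  funext x
  simp [pd, fderiv_add (hf.differentiable (by simp) x) (hg.differentiable (by simp) x)]

lemma pd_smul {f : E3 → E3} (hf : ContDiff ℝ ∞ f) (c : ℝ) (i : Fin 3) :
    pd i (c • f) = c • pd i f := by
  funext x
  simp [pd, fderiv_const_smul (hf.differentiable (by simp) x)]

lemma contDiff_pd_iterate {f : E3 → E3} (hf : ContDiff ℝ ∞ f) (i : Fin 3) (k : ℕ) :
    ContDiff ℝ ∞ ((pd i)^[k] f) := by
  induction k with
  | zero => simpa using hf
  | succ k ih => rw [Function.iterate_succ_apply']; exact contDiff_pd ih i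

lemma pd_iterate_add {f g : E3 → E3} (hf : ContDiff ℝ ∞ f) (hg : ContDiff ℝ ∞ g)
    (i : Fin 3) (k : ℕ) : (pd i)^[k] (f + g) = (pd i)^[k] f + (pd i)^[k] g := by
  induction k with
  | zero => simp
  | succ k ih =>
    simp only [Function.iterate_succ_apply', ih]
    exact pd_add (contDiff_pd_iterate hf i k) (contDiff_pd_iterate hg i k) i

lemma pd_iterate_smul {f : E3 → E3} (hf : ContDiff ℝ ∞ f) (c : ℝ)
    (i : Fin 3) (k : ℕ) : (pd i)^[k] (c • f) = c • (pd i)^[k] f := by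
  induction k with
  | zero => simp
  | succ k ih =>
    simp only [Function.iterate_succ_apply', ih]
    exact pd_smul (contDiff_pd_iterate hf i k) c i

lemma contDiff_pdMulti {f : E3 → E3} (hf : ContDiff ℝ ∞ f) (α : Fin 3 → ℕ) :
    ContDiff ℝ ∞ (pdMulti α f) :=
  contDiff_pd_iterate (contDiff_pd_iterate (contDiff_pd_iterate hf _ _) _ _) _ _

lemma pdMulti_add {f g : E3 → E3} (hf : ContDiff ℝ ∞ f) (hg : ContDiff ℝ ∞ g)
    (α : Fin 3 → ℕ) : pdMulti α (f + g) = pdMulti α f + pdMulti α g := by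
  unfold pdMulti
  rw [pd_iterate_add hf hg,
    pd_iterate_add (contDiff_pd_iterate hf _ _) (contDiff_pd_iterate hg _ _),
    pd_iterate_add (contDiff_pd_iterate (contDiff_pd_iterate hf _ _) _ _)
      (contDiff_pd_iterate (contDiff_pd_iterate hg _ _) _ _)]

lemma pdMulti_smul {f : E3 → E3} (hf : ContDiff ℝ ∞ f) (c : ℝ)
    (α : Fin 3 → ℕ) : pdMulti α (c • f) = c • pdMulti α f := by
  unfold pdMulti
  rw [pd_iterate_smul hf, pd_iterate_smul (contDiff_pd_iterate hf _ _),
    pd_iterate_smul (contDiff_pd_iterate (contDiff_pd_iterate hf _ _) _ _)]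

/-- The smooth, `2π`-periodic, mean-free and divergence-free vector fields, as a linear subspace of
all vector fields. On the torus `H^∞ = C^∞`. -/
noncomputable def fieldSubmodule : Submodule ℝ (E3 → E3) where
  carrier := {U | ContDiff ℝ ∞ U ∧ IsPeriodic U ∧ (∫ x in cell, U x) = 0 ∧
    ∀ x, divergence U x = 0}
  zero_mem' := by
    refine ⟨contDiff_const, fun i x => rfl, by simp, fun x => ?_⟩
    have h (i : Fin 3) : pd i (0 : E3 → E3) = 0 := by
      funext y; simp [pd]
    simp [divergence, h]
  add_mem' := by
    rintro U V ⟨hU, pU, mU, dU⟩ ⟨hV, pV, mV, dV⟩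
    refine ⟨hU.add hV, fun i x => ?_, ?_, fun x => ?_⟩
    · simp [pU i x, pV i x]
    · have iU : Integrable U (volume.restrict cell) :=
        memLp_one_iff_integrable.1 (memLp_of_continuous hU.continuous 1)
      have iV : Integrable V (volume.restrict cell) :=
        memLp_one_iff_integrable.1 (memLp_of_continuous hV.continuous 1)
      simp only [Pi.add_apply]
      rw [integral_add iU iV, mU, mV, add_zero]
    · have := dU x
      have := dV x
      simp only [divergence, pd_add hU hV, Pi.add_apply, PiLp.add_apply,
        Finset.sum_add_distrib] at *
      linarith
  smul_mem' := by
    rintro c U ⟨hU, pU, mU, dU⟩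
    refine ⟨hU.const_smul c, fun i x => ?_, ?_, fun x => ?_⟩
    · simp [pU i x]
    · simp only [Pi.smul_apply]
      rw [integral_smul, mU, smul_zero]
    · have := dU x
      simp only [divergence, pd_smul hU, Pi.smul_apply, PiLp.smul_apply, smul_eq_mul,
        ← Finset.mul_sum] at *
      rw [this, mul_zero]

/-- The space `Ḣ^∞_div` of smooth mean-free divergence-free fields on `𝕋³`. It is a type of its own
(not an abbreviation of a subspace of functions), so that the only topology on it is the one of the
metric `d_{H^∞}` below. -/
def HDiv : Type := ↥fieldSubmodule

noncomputable instance : AddCommGroup HDiv := inferInstanceAs (AddCommGroup ↥fieldSubmodule)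
noncomputable instance : Module ℝ HDiv := inferInstanceAs (Module ℝ ↥fieldSubmodule)

/-- The underlying vector field. -/
def HDiv.field (U : HDiv) : E3 → E3 := U.1

lemma HDiv.contDiff (U : HDiv) : ContDiff ℝ ∞ U.field := U.2.1
lemma HDiv.periodic (U : HDiv) : IsPeriodic U.field := U.2.2.1
lemma HDiv.field_add (U V : HDiv) : (U + V).field = U.field + V.field := rfl
lemma HDiv.field_neg (U : HDiv) : (-U).field = -U.field := rfl
lemma HDiv.field_sub (U V : HDiv) : (U - V).field = U.field - V.field := rfl
lemma HDiv.field_smul (c : ℝ) (U : HDiv) : (c • U).field = c • U.field := rfl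

/-- The `L²(𝕋³)` norm of a vector field. -/
noncomputable def l2Norm (f : E3 → E3) : ℝ := (eLpNorm f 2 (volume.restrict cell)).toReal

/-- The multi-indices of order at most `n`. -/
def multiIndices (n : ℕ) : Finset (Fin 3 → ℕ) :=
  (Fintype.piFinset fun _ => Finset.range (n + 1)).filter fun α => ∑ i, α i ≤ n

/-- The Sobolev norm `‖U‖_{H^n} = (∑_{|α| ≤ n} ‖∂^α U‖²_{L²})^{1/2}`. -/
noncomputable def sobolevNorm (n : ℕ) (U : HDiv) : ℝ :=
  √(∑ α ∈ multiIndices n, l2Norm (pdMulti α U.field) ^ 2)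

lemma l2Norm_nonneg (f : E3 → E3) : 0 ≤ l2Norm f := ENNReal.toReal_nonneg

lemma l2Norm_add_le {f g : E3 → E3} (hf : Continuous f) (hg : Continuous g) :
    l2Norm (f + g) ≤ l2Norm f + l2Norm g := by
  have mf := memLp_of_continuous hf 2
  have mg := memLp_of_continuous hg 2
  unfold l2Norm
  rw [← ENNReal.toReal_add mf.eLpNorm_ne_top mg.eLpNorm_ne_top]
  exact ENNReal.toReal_mono (ENNReal.add_ne_top.2 ⟨mf.eLpNorm_ne_top, mg.eLpNorm_ne_top⟩)
    (eLpNorm_add_le mf.1 mg.1 (by norm_num))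

lemma sobolevNorm_nonneg (n : ℕ) (U : HDiv) : 0 ≤ sobolevNorm n U := Real.sqrt_nonneg _

lemma sobolevNorm_add_le (n : ℕ) (U V : HDiv) :
    sobolevNorm n (U + V) ≤ sobolevNorm n U + sobolevNorm n V := by
  have key := Real.Lp_add_le_of_nonneg (multiIndices n) (p := 2) (by norm_num)
    (f := fun α => l2Norm (pdMulti α U.field)) (g := fun α => l2Norm (pdMulti α V.field))
    (fun _ _ => l2Norm_nonneg _) (fun _ _ => l2Norm_nonneg _)
  simp only [Real.rpow_two, ← Real.sqrt_eq_rpow] at key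
  refine le_trans (Real.sqrt_le_sqrt (Finset.sum_le_sum fun α _ => ?_)) key
  refine pow_le_pow_left₀ (l2Norm_nonneg _) ?_ 2
  rw [HDiv.field_add, pdMulti_add U.contDiff V.contDiff]
  exact l2Norm_add_le (contDiff_pdMulti U.contDiff α).continuous
    (contDiff_pdMulti V.contDiff α).continuous

lemma sobolevNorm_neg (n : ℕ) (U : HDiv) : sobolevNorm n (-U) = sobolevNorm n U := by
  have h (α : Fin 3 → ℕ) : pdMulti α (-U).field = -pdMulti α U.field := by
    have := pdMulti_smul U.contDiff (-1) α
    simpa [HDiv.field_neg] using this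
  simp only [sobolevNorm, h, l2Norm, eLpNorm_neg]

lemma sobolevNorm_zero (n : ℕ) : sobolevNorm n 0 = 0 := by
  have h (α : Fin 3 → ℕ) : pdMulti α (0 : HDiv).field = 0 := by
    have := pdMulti_smul (0 : HDiv).contDiff 0 α
    rw [← HDiv.field_smul, smul_zero, zero_smul] at this
    exact this
  simp [sobolevNorm, h, l2Norm]

/-- The metric `d_{H^∞}(U, V) = ∑_{n ≥ 0} 2^{-n} ‖U - V‖_{H^n} / (1 + ‖U - V‖_{H^n})`. -/
noncomputable def dHInf (U V : HDiv) : ℝ :=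
  ∑' n : ℕ, (1 / 2 : ℝ) ^ n * (sobolevNorm n (U - V) / (1 + sobolevNorm n (U - V)))

lemma summable_dHInf (U V : HDiv) : Summable fun n : ℕ =>
    (1 / 2 : ℝ) ^ n * (sobolevNorm n (U - V) / (1 + sobolevNorm n (U - V))) := by
  refine Summable.of_nonneg_of_le (fun n => ?_) (fun n => ?_) summable_geometric_two
  · have := sobolevNorm_nonneg n (U - V); positivity
  · have := sobolevNorm_nonneg n (U - V)
    refine mul_le_of_le_one_right (by positivity) ?_
    rw [div_le_one (by positivity)]
    linarith

/-- A field whose `L²` norm vanishes on the cell is zero. -/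
lemma HDiv.eq_zero_of_l2Norm (U : HDiv) (h : l2Norm U.field = 0) : U = 0 := by
  have hm := memLp_of_continuous U.contDiff.continuous 2
  have h0 : eLpNorm U.field 2 (volume.restrict cell) = 0 :=
    (ENNReal.toReal_eq_zero_iff _).1 h |>.resolve_right hm.eLpNorm_ne_top
  have hae : U.field =ᵐ[volume.restrict cell] 0 :=
    (eLpNorm_eq_zero_iff hm.1 (by norm_num)).1 h0
  -- translates by multiples of the period
  have hper : ∀ (i : Fin 3) (m : ℤ) (x : E3),
      U.field (x + EuclideanSpace.single i ((m : ℝ) * (2 * Real.pi))) = U.field x := by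
    intro i m
    have hp : Function.Periodic U.field (EuclideanSpace.single i (2 * Real.pi)) := U.periodic i
    intro x
    have := hp.zsmul m x
    have e : m • (EuclideanSpace.single i (2 * Real.pi) : E3)
        = EuclideanSpace.single i ((m : ℝ) * (2 * Real.pi)) := by
      ext k
      by_cases hk : k = i <;> simp [hk]
    rwa [e] at this
  have hinter : ∀ x ∈ interior cell, U.field x = 0 := by
    have hae' : U.field =ᵐ[volume.restrict (interior cell)] 0 :=
      ae_restrict_of_ae_restrict_of_subset interior_subset hae
    exact fun x hx => Measure.eqOn_open_of_ae_eq hae' isOpen_interior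
      U.contDiff.continuous.continuousOn continuousOn_const hx
  have hclos : ∀ x ∈ cell, U.field x = 0 := by
    have hcl : IsClosed {x | U.field x = 0} :=
      isClosed_eq U.contDiff.continuous continuous_const
    have hsub : closure (interior cell) ⊆ {x | U.field x = 0} :=
      hcl.closure_subset_iff.2 hinter
    refine fun x hx => hsub ?_
    have hopen : {y : E3 | ∀ i, y i ∈ Ioo (0 : ℝ) (2 * Real.pi)} ⊆ interior cell := by
      refine interior_maximal (fun y hy i => ⟨(hy i).1.le, (hy i).2⟩) ?_
      simp only [Set.ofPred_forall]
      refine isOpen_iInter_of_finite fun i => ?_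
      exact isOpen_Ioo.preimage (EuclideanSpace.proj i : E3 →L[ℝ] ℝ).continuous
    refine closure_mono hopen ?_
    -- approach `x` along the segment towards the centre of the cell
    let c : E3 := WithLp.toLp 2 fun _ => Real.pi
    have hlim : Filter.Tendsto (fun t : ℝ => x + t • (c - x)) (nhdsWithin 0 (Ioo 0 1))
        (nhds x) := by
      have : Continuous fun t : ℝ => x + t • (c - x) := by fun_prop
      simpa using (this.tendsto 0).mono_left nhdsWithin_le_nhds
    have : (nhdsWithin (0 : ℝ) (Ioo 0 1)).NeBot := left_nhdsWithin_Ioo_neBot one_pos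
    refine mem_closure_of_tendsto hlim ?_
    filter_upwards [self_mem_nhdsWithin] with t ht i
    have h1 := (hx i).1
    have h2 := (hx i).2
    have hπ := Real.pi_pos
    have hval : (x + t • (c - x)) i = (1 - t) * x i + t * Real.pi := by
      simp [c]; ring
    rw [hval]
    have ht0 := ht.1
    have ht1 := ht.2
    constructor <;> nlinarith
  apply Subtype.ext
  funext x
  change U.field x = 0
  have h2π : (0 : ℝ) < 2 * Real.pi := by positivity
  let m : Fin 3 → ℤ := fun i => -⌊x i / (2 * Real.pi)⌋
  let y : E3 := x + EuclideanSpace.single 0 ((m 0 : ℝ) * (2 * Real.pi))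
    + EuclideanSpace.single 1 ((m 1 : ℝ) * (2 * Real.pi))
    + EuclideanSpace.single 2 ((m 2 : ℝ) * (2 * Real.pi))
  have hy : U.field y = U.field x := by
    simp only [y, hper]
  rw [← hy]
  apply hclos
  intro i
  have hyi : y i = x i - ⌊x i / (2 * Real.pi)⌋ * (2 * Real.pi) := by
    fin_cases i <;> simp [y, m] <;> ring
  rw [hyi]
  have f1 := Int.floor_le (x i / (2 * Real.pi))
  have f2 := Int.lt_floor_add_one (x i / (2 * Real.pi))
  rw [le_div_iff₀ h2π] at f1
  rw [div_lt_iff₀ h2π] at f2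
  constructor <;> linarith

/-- `Ḣ^∞_div` with its Fréchet metric `d_{H^∞}`. -/
noncomputable instance : MetricSpace HDiv where
  dist := dHInf
  dist_self U := by simp [dHInf, sobolevNorm_zero]
  dist_comm U V := by
    have h (n : ℕ) : sobolevNorm n (U - V) = sobolevNorm n (V - U) := by
      rw [← neg_sub V U, sobolevNorm_neg]
    simp only [dHInf, h]
  dist_triangle U V W := by
    unfold dHInf
    rw [← (summable_dHInf U V).tsum_add (summable_dHInf V W)]
    refine (summable_dHInf U W).tsum_le_tsum (fun n => ?_)
      ((summable_dHInf U V).add (summable_dHInf V W))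
    rw [← mul_add]
    refine mul_le_mul_of_nonneg_left ?_ (by positivity)
    have h := sobolevNorm_add_le n (U - V) (V - W)
    rw [sub_add_sub_cancel] at h
    have ha := sobolevNorm_nonneg n (U - V)
    have hb := sobolevNorm_nonneg n (V - W)
    have hc := sobolevNorm_nonneg n (U - W)
    generalize sobolevNorm n (U - V) = a at *
    generalize sobolevNorm n (V - W) = b at *
    generalize sobolevNorm n (U - W) = c at *
    calc c / (1 + c) ≤ (a + b) / (1 + (a + b)) := by
          rw [div_le_div_iff₀ (by positivity) (by positivity)]; nlinarith
      _ = a / (1 + (a + b)) + b / (1 + (a + b)) := add_div _ _ _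
      _ ≤ a / (1 + a) + b / (1 + b) := by
          gcongr <;> linarith
  eq_of_dist_eq_zero := by
    intro U V h
    change dHInf U V = 0 at h
    have hnn (n : ℕ) : 0 ≤ (1 / 2 : ℝ) ^ n *
        (sobolevNorm n (U - V) / (1 + sobolevNorm n (U - V))) := by
      have := sobolevNorm_nonneg n (U - V); positivity
    have hsum := (summable_dHInf U V).hasSum
    rw [← dHInf, h] at hsum
    have h0 := (hasSum_zero_iff_of_nonneg hnn).1 hsum
    have h1 := congrFun h0 0
    have hs := sobolevNorm_nonneg 0 (U - V)
    simp only [pow_zero, one_mul, Pi.zero_apply, div_eq_zero_iff] at h1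
    have h2 : sobolevNorm 0 (U - V) = 0 := h1.resolve_right (by linarith)
    have h3 : multiIndices 0 = {0} := by decide
    have h4 : l2Norm (U - V).field = 0 := by
      rw [sobolevNorm, h3, Finset.sum_singleton, Real.sqrt_sq (l2Norm_nonneg _)] at h2
      simpa [pdMulti] using h2
    exact sub_eq_zero.1 (HDiv.eq_zero_of_l2Norm _ h4)

/-! ### The cell problem, the alpha-matrix and alpha-instability -/

/-- The Hilbert space `L²(𝕋³; ℂ³)`. -/
abbrev L2Torus : Type := Lp (EuclideanSpace ℂ (Fin 3)) 2 (volume.restrict cell)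

/-- `S ∈ L²(𝕋³; ℂ³)` is mean-free and solves `∇ × (U × S) + Δ S = ∇ × (v × U)` on `𝕋³` in the sense
of distributions, that is, against all smooth periodic test fields `φ` (curl and Laplacian are
symmetric for the bilinear pairing `∫ F ⬝ φ`). -/
def IsCellSolution (U : E3 → E3) (v : Fin 3 → ℂ) (S : L2Torus) : Prop :=
  (∫ x in cell, S x) = 0 ∧
  ∀ φ : E3 → Fin 3 → ℂ, ContDiff ℝ ∞ φ → IsPeriodic φ →
    ∫ x in cell, ((cplx (U x) ⨯₃ (S x).ofLp) ⬝ᵥ curl φ x + (S x).ofLp ⬝ᵥ vecLaplacian φ x)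
      = ∫ x in cell, (v ⨯₃ cplx (U x)) ⬝ᵥ curl φ x

/-- `𝒮` is the solution map of the cell problem: for each `v`, the field `𝒮 v` is the one and only
solution. -/
def IsSolutionMap (U : E3 → E3) (𝒮 : (Fin 3 → ℂ) → L2Torus) : Prop :=
  ∀ v S, IsCellSolution U v S ↔ S = 𝒮 v

/-- `A` is the alpha-matrix `A(U, j)`: `A v = i (j / |j|) × ⨍ U × 𝒮(v)` for all `v ∈ ℂ³`, where `𝒮`
is the solution map of the cell problem. -/
def IsAlphaMatrix (U : E3 → E3) (j : E3) (A : Matrix (Fin 3) (Fin 3) ℂ) : Prop :=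
  ∃ 𝒮 : (Fin 3 → ℂ) → L2Torus, IsSolutionMap U 𝒮 ∧
    ∀ v, A *ᵥ v = Complex.I •
      (cplx (‖j‖⁻¹ • j) ⨯₃ (⨍ x in cell, cplx (U x) ⨯₃ (𝒮 v x).ofLp))

/-- Alpha-instability of a (smooth, mean-free, divergence-free) field: `‖∇U‖_{L^∞} < 1` and, for
some `j ≠ 0`, the alpha-matrix `A(U, j)` has an eigenvalue of algebraic multiplicity one with
positive real part. -/
def AlphaUnstable (U : HDiv) : Prop :=
  (⨆ x, ‖fderiv ℝ U.field x‖ₑ) < 1 ∧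
  ∃ j : E3, j ≠ 0 ∧ ∃ A : Matrix (Fin 3) (Fin 3) ℂ, IsAlphaMatrix U.field j A ∧
    ∃ p : ℂ, 0 < p.re ∧ A.charpoly.rootMultiplicity p = 1

/-- The set `Ω` of fields a positive multiple of which is alpha-unstable. -/
def Omega : Set HDiv := {U | ∃ δ : ℝ, 0 < δ ∧ AlphaUnstable (δ • U)}

end AlphaDynamo

/-! Since `v × U = -U × v`, the cell problem says `-ΔS = ∇ × (U × (S + v))`. With `K_U = (-Δ)⁻¹ ∇ ×
(U × ·)`, a compact operator on `L²`, it becomes `(1 - K_U) S = K_U v` (`isCellSolution_iff`). By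
the Fredholm alternative, unique solvability is the same as invertibility of `1 - K_U`, and the
alpha-matrix is then an explicit expression in `(1 - K_U)⁻¹` (`isAlphaMatrix_iff`).

Openness: the Sobolev embedding of `H⁵` in `C¹` makes the gradient bound an open condition and `U ↦
U ∈ L^∞` continuous. Invertibility is open, the alpha-matrix is continuous in the `L^∞` class of
`U`, and having a simple eigenvalue in the open right half-plane is an open condition on matrices
(`isOpen_simpleUnstable`).

Membership: as `δ → 0`, `δ⁻² A(δU, j)` tends to `i ĵ × M`, where `M v = ⨍ U × K_U v`. The operator
`(-Δ)⁻¹ ∇ ×` is self-adjoint and preserves real fields, so `M` is real symmetric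
(`exists_real_symm`). The characteristic polynomial of `i ĵ × M` is `p³ - μ p` with `μ = ĵ · adj(M)
ĵ`. If `det M ≠ 0`, then `adj M` is not negative semidefinite, because `det (-adj M) = -(det M)² <
0` in dimension three. So some `j` gives `μ > 0`, and `√μ` is a simple unstable eigenvalue
(`exists_simpleUnstable`), which persists for small `δ > 0` (`mem_Omega_of_det_ne_zero`).

Density: `M` is quadratic in the field, and for the ABC flow it equals `-1` (`matOf_quadResp_abc`).
Along `U + t · abc` the determinant of `M` is therefore a polynomial in `t` that is not identically
zero, so it is nonzero for all small `t ≠ 0` (`eventually_det_ne_zero`). -/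

namespace AlphaDynamo

/-! ### Calculus of periodic functions on the cell -/

lemma measurableSet_cell : MeasurableSet cell := by
  have : cell = (WithLp.ofLp : E3 → Fin 3 → ℝ) ⁻¹' (Set.univ.pi fun _ => Ico 0 (2 * Real.pi)) := by
    ext x; simp [cell]
  rw [this]
  exact (PiLp.volume_preserving_ofLp (Fin 3)).measurable
    (MeasurableSet.univ_pi fun _ => measurableSet_Ico)

/-- An integral over the cell as an integral over a box in `Fin 3 → ℝ`. -/
lemma setIntegral_cell_eq {F : Type*} [NormedAddCommGroup F] [NormedSpace ℝ F] (f : E3 → F) :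
    ∫ x in cell, f x = ∫ y in Icc (0 : Fin 3 → ℝ) (fun _ => 2 * Real.pi), f (WithLp.toLp 2 y) := by
  have h := (PiLp.volume_preserving_ofLp (Fin 3)).setIntegral_preimage_emb
    (MeasurableEquiv.toLp 2 (Fin 3 → ℝ)).symm.measurableEmbedding
    (fun y => f (WithLp.toLp 2 y)) (Set.univ.pi fun _ => Ico 0 (2 * Real.pi))
  have hc : (WithLp.ofLp : E3 → Fin 3 → ℝ) ⁻¹' (Set.univ.pi fun _ => Ico 0 (2 * Real.pi))
      = cell := by
    ext x; simp [cell]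
  rw [hc] at h
  refine Eq.trans (by simpa using h) ?_
  -- The half-open and closed boxes differ by a null set; the closed one is the form used by the
  -- divergence theorem.
  exact setIntegral_congr_set Measure.univ_pi_Ico_ae_eq_Icc

/-- Every point has a representative in the cell, at which all periodic functions agree. -/
lemma exists_mem_cell (x : E3) :
    ∃ y ∈ cell, ∀ {F : Type*} (f : E3 → F), IsPeriodic f → f y = f x := by
  have h2π : (0 : ℝ) < 2 * Real.pi := by positivity
  let m : Fin 3 → ℤ := fun i => -⌊x i / (2 * Real.pi)⌋
  let y : E3 := x + EuclideanSpace.single 0 ((m 0 : ℝ) * (2 * Real.pi))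
    + EuclideanSpace.single 1 ((m 1 : ℝ) * (2 * Real.pi))
    + EuclideanSpace.single 2 ((m 2 : ℝ) * (2 * Real.pi))
  refine ⟨y, fun i => ?_, fun f hf => ?_⟩
  · have hyi : y i = x i - ⌊x i / (2 * Real.pi)⌋ * (2 * Real.pi) := by
      fin_cases i <;> simp [y, m] <;> ring
    rw [hyi]
    have f1 := Int.floor_le (x i / (2 * Real.pi))
    have f2 := Int.lt_floor_add_one (x i / (2 * Real.pi))
    rw [le_div_iff₀ h2π] at f1
    rw [div_lt_iff₀ h2π] at f2
    constructor <;> linarith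
  · have hper : ∀ (i : Fin 3) (m : ℤ) (x : E3),
        f (x + EuclideanSpace.single i ((m : ℝ) * (2 * Real.pi))) = f x := by
      intro i m x
      have hp : Function.Periodic f (EuclideanSpace.single i (2 * Real.pi)) := hf i
      have := hp.zsmul m x
      have e : m • (EuclideanSpace.single i (2 * Real.pi) : E3)
          = EuclideanSpace.single i ((m : ℝ) * (2 * Real.pi)) := by
        ext k
        by_cases hk : k = i <;> simp [hk]
      rwa [e] at this
    simp only [y, hper]

/-- A convex set with nonempty interior lies in the closure of that interior. This carries
identities from the open cell, where almost everywhere equality of continuous functions is equality,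
to its boundary faces. -/
lemma closure_interior_cell : cell ⊆ closure (interior cell) := by
  have hopen : {y : E3 | ∀ i, y i ∈ Ioo (0 : ℝ) (2 * Real.pi)} ⊆ interior cell := by
    refine interior_maximal (fun y hy i => ⟨(hy i).1.le, (hy i).2⟩) ?_
    simp only [Set.ofPred_forall]
    refine isOpen_iInter_of_finite fun i => ?_
    exact isOpen_Ioo.preimage (EuclideanSpace.proj i : E3 →L[ℝ] ℝ).continuous
  have hconv : Convex ℝ cell := by
    intro x hx y hy a b ha hb hab i
    exact (convex_Ico (0 : ℝ) (2 * Real.pi)) (hx i) (hy i) ha hb hab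
  have hne : (interior cell).Nonempty :=
    ⟨WithLp.toLp 2 fun _ => Real.pi, hopen fun i => by
      have := Real.pi_pos
      constructor <;> simp <;> linarith⟩
  rw [hconv.closure_interior_eq_closure_of_nonempty_interior hne]
  exact subset_closure

/-- A continuous periodic function that vanishes almost everywhere on the cell vanishes. -/
lemma eq_zero_of_ae_cell {F : Type*} [NormedAddCommGroup F] {f : E3 → F} (hf : Continuous f)
    (hp : IsPeriodic f) (h : f =ᵐ[volume.restrict cell] 0) : f = 0 := by
  have hinter : interior cell ⊆ {x | f x = 0} := fun x hx =>
    Measure.eqOn_open_of_ae_eq (ae_restrict_of_ae_restrict_of_subset interior_subset h)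
      isOpen_interior hf.continuousOn continuousOn_const hx
  have hcl : IsClosed {x | f x = 0} := isClosed_eq hf continuous_const
  funext x
  obtain ⟨y, hy, hyx⟩ := exists_mem_cell x
  rw [← hyx f hp]
  exact hcl.closure_subset_iff.2 hinter (closure_interior_cell hy)

lemma memLp_cell {F : Type*} [NormedAddCommGroup F] {f : E3 → F}
    (hf : Continuous f) (p : ℝ≥0∞) : MemLp f p (volume.restrict cell) := by
  obtain ⟨C, hC⟩ := isBounded_cell.isCompact_closure.exists_bound_of_continuousOn hf.continuousOn
  refine MemLp.of_bound hf.aestronglyMeasurable C ?_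
  exact ae_restrict_of_forall_mem measurableSet_cell fun x hx => hC x (subset_closure hx)

lemma integrable_cell {F : Type*} [NormedAddCommGroup F] {f : E3 → F}
    (hf : Continuous f) : Integrable f (volume.restrict cell) :=
  memLp_one_iff_integrable.1 (memLp_cell hf 1)

lemma IsPeriodic.pd {F : Type*} [NormedAddCommGroup F] [NormedSpace ℝ F] {f : E3 → F}
    (hp : IsPeriodic f) (i : Fin 3) : IsPeriodic (pd i f) := by
  intro j x
  have h : (fun y => f (y + EuclideanSpace.single j (2 * Real.pi))) = f := funext (hp j)
  simp only [AlphaDynamo.pd]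
  conv_rhs => rw [← h]
  rw [fderiv_comp_add_right]

lemma continuous_pd {F : Type*} [NormedAddCommGroup F] [NormedSpace ℝ F] {f : E3 → F}
    (hf : ContDiff ℝ 1 f) (i : Fin 3) : Continuous (pd i f) :=
  (hf.continuous_fderiv one_ne_zero).clm_apply continuous_const

lemma ContDiff.pd_infty {F : Type*} [NormedAddCommGroup F] [NormedSpace ℝ F] {f : E3 → F}
    (hf : ContDiff ℝ ∞ f) (i : Fin 3) : ContDiff ℝ ∞ (pd i f) :=
  (hf.fderiv_right (m := ∞) (by simp)).clm_apply contDiff_const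

/-- The integral of a partial derivative of a periodic function vanishes. -/
theorem integral_pd_eq_zero {F : Type*} [NormedAddCommGroup F] [NormedSpace ℝ F] {f : E3 → F}
    (hf : ContDiff ℝ 1 f) (hp : IsPeriodic f) (i : Fin 3) : ∫ x in cell, pd i f x = 0 := by
  -- In an incomplete space the Bochner integral is zero by definition.
  by_cases hF : CompleteSpace F
  swap
  · simp [integral, hF]
  let L : (Fin 3 → ℝ) →L[ℝ] E3 := (EuclideanSpace.equiv (Fin 3) ℝ).symm.toContinuousLinearMap
  -- The vector field whose only nonzero component is the `i`-th, equal to `f`, has divergence `∂ᵢ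
  -- f`.
  let g : Fin 3 → (Fin 3 → ℝ) → F := fun j y => if j = i then f (L y) else 0
  let g' : Fin 3 → (Fin 3 → ℝ) → (Fin 3 → ℝ) →L[ℝ] F :=
    fun j y => if j = i then (fderiv ℝ f (L y)).comp L else 0
  have hsum : ∀ y, ∑ j, g' j y (Pi.single j 1) = pd i f (L y) := by
    intro y
    rw [Finset.sum_eq_single i]
    · simp only [g', if_true, pd, ContinuousLinearMap.comp_apply]
      rfl
    · intro j _ hj; simp [g', hj]
    · simp
  have hcont : Continuous fun y => pd i f (L y) := (continuous_pd hf i).comp L.continuous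
  have key := integral_divergence_of_hasFDerivAt_off_countable' (n := 2)
    (0 : Fin 3 → ℝ) (fun _ => 2 * Real.pi) (fun _ => by simp; positivity) g g' ∅
    Set.countable_empty (fun j => by
      by_cases hj : j = i
      · simp only [g, hj, if_true]
        exact (hf.continuous.comp L.continuous).continuousOn
      · simp only [g, hj, if_false]; exact continuousOn_const)
    (fun y _ j => by
      by_cases hj : j = i
      · simp only [g, g', hj, if_true]
        exact ((hf.differentiable one_ne_zero) (L y)).hasFDerivAt.comp y L.hasFDerivAt
      · simp only [g, g', hj, if_false]; exact hasFDerivAt_const _ _)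
    (by
      simp only [hsum]
      exact hcont.continuousOn.integrableOn_compact isCompact_Icc)
  simp only [hsum] at key
  rw [setIntegral_cell_eq]
  refine Eq.trans key (Finset.sum_eq_zero fun j _ => ?_)
  rw [sub_eq_zero]
  congr 1
  funext y
  by_cases hj : j = i
  · subst hj
    simp only [g, if_true]
    -- Periodicity moves the face at `0` onto the face at `2π`, so the two boundary terms cancel.
    rw [← hp j (L (j.insertNth ((0 : Fin 3 → ℝ) j) y))]
    congr 1
    ext k
    rcases Fin.eq_self_or_eq_succAbove j k with rfl | ⟨l, rfl⟩
    · simp [L]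
    · simp [L]
  · simp [g, hj]

/-! ### Characters and Fourier coefficients -/

/-- The character `e^{ik·x}`. -/
noncomputable def chr (k : Fin 3 → ℤ) (x : E3) : ℂ :=
  Complex.exp (Complex.I * ∑ i, (k i : ℂ) * (x i : ℂ))

lemma contDiff_chr (k : Fin 3 → ℤ) {n : WithTop ℕ∞} : ContDiff ℝ n (chr k) := by
  unfold chr
  refine ContDiff.cexp (contDiff_const.mul (ContDiff.sum fun i _ => contDiff_const.mul ?_))
  exact Complex.ofRealCLM.contDiff.comp (EuclideanSpace.proj i : E3 →L[ℝ] ℝ).contDiff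

lemma continuous_chr (k : Fin 3 → ℤ) : Continuous (chr k) :=
  (contDiff_chr k (n := 0)).continuous

lemma periodic_chr (k : Fin 3 → ℤ) : IsPeriodic (chr k) := by
  intro i x
  have : (Complex.I * ∑ j, (k j : ℂ) *
      (((x + EuclideanSpace.single i (2 * Real.pi) : E3) j : ℝ) : ℂ))
      = Complex.I * ∑ j, (k j : ℂ) * (x j : ℂ) + (k i : ℂ) * (2 * Real.pi * Complex.I) := by
    have h : ∀ j, (k j : ℂ) * (((x + EuclideanSpace.single i (2 * Real.pi) : E3) j : ℝ) : ℂ)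
        = (k j : ℂ) * (x j : ℂ) + (if j = i then (k i : ℂ) * (2 * Real.pi) else 0) := by
      intro j
      by_cases hj : j = i
      · subst hj; simp; ring
      · simp [hj]
    simp only [h, Finset.sum_add_distrib, Finset.sum_ite_eq', Finset.mem_univ, if_true]
    ring
  rw [chr, chr, this, Complex.exp_add, Complex.exp_int_mul_two_pi_mul_I, mul_one]

lemma norm_chr (k : Fin 3 → ℤ) (x : E3) : ‖chr k x‖ = 1 := by
  rw [chr, mul_comm]
  have : (∑ i, (k i : ℂ) * (x i : ℂ)) = ((∑ i, (k i : ℝ) * x i : ℝ) : ℂ) := by push_cast; rfl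
  rw [this, Complex.norm_exp_ofReal_mul_I]

lemma conj_chr (k : Fin 3 → ℤ) (x : E3) : (starRingEnd ℂ) (chr k x) = chr (-k) x := by
  rw [chr, chr, ← Complex.exp_conj]
  simp

lemma chr_mul (k l : Fin 3 → ℤ) (x : E3) : chr k x * chr l x = chr (k + l) x := by
  rw [chr, chr, chr, ← Complex.exp_add, ← mul_add, ← Finset.sum_add_distrib]
  congr 2
  refine Finset.sum_congr rfl fun i _ => ?_
  simp; ring

lemma chr_zero (x : E3) : chr 0 x = 1 := by simp [chr]

lemma pd_chr (k : Fin 3 → ℤ) (i : Fin 3) (x : E3) :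
    pd i (chr k) x = (Complex.I * k i) * chr k x := by
  have h : HasFDerivAt (fun y : E3 => Complex.I * ∑ j, (k j : ℂ) * ((y j : ℝ) : ℂ))
      (Complex.I • ∑ j, (k j : ℂ) • (Complex.ofRealCLM.comp
        (EuclideanSpace.proj j : E3 →L[ℝ] ℝ))) x := by
    refine HasFDerivAt.const_mul ?_ _
    refine HasFDerivAt.fun_sum fun j _ => ?_
    exact (Complex.ofRealCLM.comp (EuclideanSpace.proj j : E3 →L[ℝ] ℝ)).hasFDerivAt.const_mul _
  have h2 := h.cexp
  rw [pd, show chr k = fun y : E3 => Complex.exp (Complex.I * ∑ j, (k j : ℂ) * ((y j : ℝ) : ℂ))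
    from rfl, h2.fderiv]
  simp [apply_ite Complex.ofReal]
  ring

/-- The (unnormalized) Fourier coefficients of a function on the cell. -/
noncomputable def fc {F : Type*} [NormedAddCommGroup F] [NormedSpace ℂ F]
    (f : E3 → F) (k : Fin 3 → ℤ) : F :=
  ∫ x in cell, chr (-k) x • f x

lemma fc_zero_eq {F : Type*} [NormedAddCommGroup F] [NormedSpace ℂ F] (f : E3 → F) :
    fc f 0 = ∫ x in cell, f x := by simp [fc, chr_zero]

lemma fc_congr_ae {F : Type*} [NormedAddCommGroup F] [NormedSpace ℂ F] {f g : E3 → F}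
    (h : f =ᵐ[volume.restrict cell] g) (k : Fin 3 → ℤ) : fc f k = fc g k := by
  refine integral_congr_ae ?_
  filter_upwards [h] with x hx
  rw [hx]

lemma integrable_chr_smul {F : Type*} [NormedAddCommGroup F] [NormedSpace ℂ F] {f : E3 → F}
    (hf : Integrable f (volume.restrict cell)) (k : Fin 3 → ℤ) :
    Integrable (fun x => chr k x • f x) (volume.restrict cell) :=
  hf.bdd_smul 1 (continuous_chr k).aestronglyMeasurable
    (Filter.Eventually.of_forall fun x => (norm_chr k x).le)

lemma fc_add {F : Type*} [NormedAddCommGroup F] [NormedSpace ℂ F] {f g : E3 → F}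
    (hf : Integrable f (volume.restrict cell)) (hg : Integrable g (volume.restrict cell))
    (k : Fin 3 → ℤ) : fc (fun x => f x + g x) k = fc f k + fc g k := by
  simp only [fc, smul_add]
  exact integral_add (integrable_chr_smul hf _) (integrable_chr_smul hg _)

lemma fc_clm {F G : Type*} [NormedAddCommGroup F] [NormedSpace ℂ F] [CompleteSpace F]
    [NormedAddCommGroup G] [NormedSpace ℂ G] [CompleteSpace G] (L : F →L[ℂ] G) {f : E3 → F}
    (hf : Integrable f (volume.restrict cell)) (k : Fin 3 → ℤ) :
    fc (fun x => L (f x)) k = L (fc f k) := by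
  rw [fc, fc, ← L.integral_comp_comm (integrable_chr_smul hf _)]
  simp

lemma norm_fc_le {F : Type*} [NormedAddCommGroup F] [NormedSpace ℂ F] (f : E3 → F)
    (k : Fin 3 → ℤ) : ‖fc f k‖ ≤ ∫ x in cell, ‖f x‖ := by
  refine (norm_integral_le_integral_norm _).trans (le_of_eq ?_)
  simp [norm_smul, norm_chr]

/-- Fourier coefficients of a partial derivative. -/
theorem fc_pd {F : Type*} [NormedAddCommGroup F] [NormedSpace ℂ F] {f : E3 → F}
    (hf : ContDiff ℝ 1 f) (hp : IsPeriodic f) (i : Fin 3) (k : Fin 3 → ℤ) :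
    fc (pd i f) k = (Complex.I * k i) • fc f k := by
  have hprod : ContDiff ℝ 1 (fun x => chr (-k) x • f x) := (contDiff_chr _).smul hf
  have hper : IsPeriodic (fun x => chr (-k) x • f x) := by
    intro j x
    simp only [periodic_chr (-k) j x, hp j x]
  -- Integration by parts: the derivative of `e^{-ik·x} f` has integral zero, and the product rule
  -- splits it.
  have h0 := integral_pd_eq_zero hprod hper i
  have hd : ∀ x, pd i (fun x => chr (-k) x • f x) x
      = chr (-k) x • pd i f x - (Complex.I * k i) • chr (-k) x • f x := by
    intro x
    have h1 := ((contDiff_chr (-k) (n := 1)).differentiable one_ne_zero x).hasFDerivAt.smul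
      (hf.differentiable one_ne_zero x).hasFDerivAt
    have h2 := pd_chr (-k) i x
    rw [pd] at h2
    rw [pd]
    erw [h1.fderiv]
    simp only [add_apply, smul_apply,
      ContinuousLinearMap.smulRight_apply, h2]
    simp [pd, smul_smul, sub_eq_add_neg]
  simp only [hd] at h0
  have i1 : Integrable (fun x => chr (-k) x • pd i f x) (volume.restrict cell) :=
    integrable_chr_smul (integrable_cell (continuous_pd hf i)) _
  have i2 : Integrable (fun x => (Complex.I * k i) • chr (-k) x • f x) (volume.restrict cell) :=
    (integrable_chr_smul (integrable_cell hf.continuous) _).smul (Complex.I * (k i : ℂ))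
  rw [integral_sub i1 i2, integral_smul, sub_eq_zero] at h0
  exact h0

/-- For `kᵢ ≠ 0` the character is a nonzero multiple of its own `i`-th derivative, whose integral
vanishes. -/
lemma integral_chr {k : Fin 3 → ℤ} (hk : k ≠ 0) : ∫ x in cell, chr k x = 0 := by
  obtain ⟨i, hi⟩ : ∃ i, k i ≠ 0 := by
    by_contra h; push Not at h; exact hk (funext h)
  have h := integral_pd_eq_zero (contDiff_chr k (n := 1)) (periodic_chr k) i
  simp only [pd_chr, integral_const_mul] at h
  refine (mul_eq_zero.1 h).resolve_left ?_
  simp [hi]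

/-! ### Completeness of the characters -/

/-- The representative in `(0, 2π]³` of a point of the torus. -/
noncomputable def torusRep (t : UnitAddTorus (Fin 3)) : E3 :=
  (2 * Real.pi) • WithLp.toLp 2 (UnitAddTorus.measurableEquivPiIoc (0 : Fin 3 → ℝ) t).1

lemma chr_torusRep (k : Fin 3 → ℤ) (t : UnitAddTorus (Fin 3)) :
    chr k (torusRep t) = UnitAddTorus.mFourier k t := by
  have ht : t = fun i => (((UnitAddTorus.measurableEquivPiIoc (0 : Fin 3 → ℝ) t).1 i : ℝ) :
      UnitAddCircle) := by
    rw [← UnitAddTorus.coe_symm_measurableEquivPiIoc_apply]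
    exact (MeasurableEquiv.symm_apply_apply _ _).symm
  conv_rhs => rw [ht]
  simp only [UnitAddTorus.mFourier, ContinuousMap.coe_mk, fourier_coe_apply]
  rw [← Complex.exp_sum, chr]
  congr 1
  rw [Finset.mul_sum]
  refine Finset.sum_congr rfl fun i _ => ?_
  simp [torusRep]
  ring

/-- `torusRep` takes values in the box closed on the right, while `cell` is closed on the left. -/
lemma box_ae_eq_cell :
    (({x : E3 | ∀ i, x i ∈ Ioc (0 : ℝ) (2 * Real.pi)}) : Set E3) =ᵐ[volume] cell := by
  have h := (Measure.univ_pi_Ioc_ae_eq_Icc (μ := fun _ : Fin 3 => (volume : Measure ℝ))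
    (f := 0) (g := fun _ => 2 * Real.pi)).trans
    (Measure.univ_pi_Ico_ae_eq_Icc (μ := fun _ : Fin 3 => (volume : Measure ℝ))
    (f := 0) (g := fun _ => 2 * Real.pi)).symm
  have h2 := (PiLp.volume_preserving_ofLp (Fin 3)).quasiMeasurePreserving.preimage_ae_eq h
  have e1 : {x : E3 | ∀ i, x i ∈ Ioc (0 : ℝ) (2 * Real.pi)}
      = (WithLp.ofLp : E3 → Fin 3 → ℝ) ⁻¹' Set.univ.pi fun i => Ioc ((0 : Fin 3 → ℝ) i) (2 * Real.pi) := by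
    ext x; simp
  have e2 : cell
      = (WithLp.ofLp : E3 → Fin 3 → ℝ) ⁻¹' Set.univ.pi fun i => Ico ((0 : Fin 3 → ℝ) i) (2 * Real.pi) := by
    ext x; simp [cell]
  rw [e1, e2]
  exact h2

/-- Transports completeness of the characters from the unit torus to the cell. Null sets and
vanishing integrals transfer for any scaling factor, so only `c ≠ 0` and `c ≠ ⊤` are recorded. -/
lemma exists_map_torusRep :
    Measurable torusRep ∧ ∃ c : ℝ≥0∞, c ≠ 0 ∧ c ≠ ⊤ ∧
      Measure.map torusRep (Measure.pi fun _ => AddCircle.haarAddCircle)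
        = c • volume.restrict cell := by
  have h1 := UnitAddTorus.measurePreserving_equivPiIoc (0 : Fin 3 → ℝ)
  have hm : MeasurableSet
      {x : Fin 3 → ℝ | ∀ i, x i ∈ Ioc ((0 : Fin 3 → ℝ) i) ((0 : Fin 3 → ℝ) i + 1)} :=
    MeasurableSet.univ_pi' (fun i => measurableSet_Ioc)
  have h2 : MeasurePreserving (Subtype.val :
      {x : Fin 3 → ℝ // ∀ i, x i ∈ Ioc ((0 : Fin 3 → ℝ) i) ((0 : Fin 3 → ℝ) i + 1)} → _)
      (Measure.comap Subtype.val volume) (volume.restrict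
        {x : Fin 3 → ℝ | ∀ i, x i ∈ Ioc ((0 : Fin 3 → ℝ) i) ((0 : Fin 3 → ℝ) i + 1)}) :=
    ⟨measurable_subtype_coe, map_comap_subtype_coe hm volume⟩
  have hmE : MeasurableSet {x : E3 | ∀ i, x i ∈ Ioc (0 : ℝ) 1} := by
    have := (PiLp.volume_preserving_ofLp (Fin 3)).measurable hm
    simpa using this
  have h3 := (PiLp.volume_preserving_toLp (Fin 3)).restrict_preimage hmE
  have h4 : {x : Fin 3 → ℝ | ∀ i, x i ∈ Ioc ((0 : Fin 3 → ℝ) i) ((0 : Fin 3 → ℝ) i + 1)}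
      = WithLp.toLp 2 ⁻¹' {x : E3 | ∀ i, x i ∈ Ioc (0 : ℝ) 1} := by ext x; simp
  rw [h4] at h2
  have h5 := h3.comp (h2.comp h1)
  have hsm : Measurable fun x : E3 => (2 * Real.pi) • x := measurable_const_smul _
  refine ⟨hsm.comp h5.measurable,
    ENNReal.ofReal |((2 * Real.pi) ^ Module.finrank ℝ E3)⁻¹|, ?_, ENNReal.ofReal_ne_top, ?_⟩
  · have := Real.pi_pos
    simp
  have hbox : {x : E3 | ∀ i, x i ∈ Ioc (0 : ℝ) 1}
      = (fun x : E3 => (2 * Real.pi) • x) ⁻¹' {x : E3 | ∀ i, x i ∈ Ioc (0 : ℝ) (2 * Real.pi)} := by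
    have h2π : 0 < 2 * Real.pi := by positivity
    ext x
    refine forall_congr' fun i => ?_
    simp [mul_pos_iff_of_pos_left h2π, mul_le_iff_le_one_right h2π]
  have hmbox : MeasurableSet {x : E3 | ∀ i, x i ∈ Ioc (0 : ℝ) (2 * Real.pi)} := by
    have := (PiLp.volume_preserving_ofLp (Fin 3)).measurable
      (MeasurableSet.univ_pi fun _ : Fin 3 => measurableSet_Ioc (a := (0 : ℝ)) (b := 2 * Real.pi))
    convert this using 1
    ext x; simp
  calc Measure.map torusRep (Measure.pi fun _ => AddCircle.haarAddCircle)
      = Measure.map (fun x : E3 => (2 * Real.pi) • x)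
          (volume.restrict {x : E3 | ∀ i, x i ∈ Ioc (0 : ℝ) 1}) := by
        rw [← h5.map_eq, Measure.map_map hsm h5.measurable]
        rfl
    _ = ENNReal.ofReal |((2 * Real.pi) ^ Module.finrank ℝ E3)⁻¹| • volume.restrict cell := by
        rw [hbox, ← Measure.restrict_map hsm hmbox,
          Measure.map_addHaar_smul _ (by positivity), Measure.restrict_smul,
          Measure.restrict_congr_set box_ae_eq_cell]

/-- A square-integrable function on the cell all of whose Fourier coefficients vanish is zero. -/
theorem ae_eq_zero_of_fc_eq_zero {f : E3 → ℂ} (hf : MemLp f 2 (volume.restrict cell))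
    (h : ∀ k, fc f k = 0) : f =ᵐ[volume.restrict cell] 0 := by
  obtain ⟨hm, c, hc0, hc, hmap⟩ := exists_map_torusRep
  have hf' : MemLp f 2 (Measure.map torusRep (Measure.pi fun _ => AddCircle.haarAddCircle)) := by
    rw [hmap]; exact hf.smul_measure hc
  have hg : MemLp (f ∘ torusRep) 2 (Measure.pi fun _ => AddCircle.haarAddCircle) :=
    (memLp_map_measure_iff hf'.1 hm.aemeasurable).1 hf'
  -- Up to the factor `c`, the torus coefficients of the pullback are the cell coefficients of `f`.
  have hrepr : UnitAddTorus.mFourierBasis.repr (hg.toLp _) = 0 := by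
    ext k
    rw [UnitAddTorus.mFourierBasis_repr]
    have e : UnitAddTorus.mFourierCoeff (hg.toLp _ : UnitAddTorus (Fin 3) → ℂ) k
        = UnitAddTorus.mFourierCoeff (f ∘ torusRep) k := by
      refine integral_congr_ae ?_
      filter_upwards [hg.coeFn_toLp] with t ht
      rw [ht]
    rw [e, UnitAddTorus.mFourierCoeff]
    have e2 : (fun t => UnitAddTorus.mFourier (-k) t • (f ∘ torusRep) t)
        = fun t => (fun x => chr (-k) x • f x) (torusRep t) := by
      funext t; simp [chr_torusRep]
    rw [e2]
    have i1 : AEStronglyMeasurable (fun x => chr (-k) x • f x)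
        (Measure.map torusRep (Measure.pi fun _ => AddCircle.haarAddCircle)) :=
      (continuous_chr _).aestronglyMeasurable.smul hf'.1
    have e3 := integral_map hm.aemeasurable i1
    rw [hmap, integral_smul_measure] at e3
    have hk := h k
    rw [fc] at hk
    rw [hk, smul_zero] at e3
    exact e3.symm
  have h0 : hg.toLp _ = 0 := by
    simpa using hrepr
  have h1 : eLpNorm (f ∘ torusRep) 2 (Measure.pi fun _ => AddCircle.haarAddCircle) = 0 := by
    rw [eLpNorm_eq_zero_iff hg.1 (by norm_num)]
    exact hg.coeFn_toLp.symm.trans ((Lp.eq_zero_iff_ae_eq_zero).1 h0)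
  rw [← eLpNorm_map_measure hf'.1 hm.aemeasurable, hmap,
    eLpNorm_smul_measure_of_ne_zero hc0] at h1
  have h2 : eLpNorm f 2 (volume.restrict cell) = 0 := by
    rw [smul_eq_mul] at h1
    refine (mul_eq_zero.1 h1).resolve_left ?_
    simp [hc0, hc]
  exact (eLpNorm_eq_zero_iff hf.1 (by norm_num)).1 h2

/-! ### The Hilbert basis of characters -/

/-- The volume of the cell. -/
noncomputable def cellVol : ℝ := (volume : Measure E3).real cell

lemma cellVol_pos : 0 < cellVol := by
  refine ENNReal.toReal_pos ?_ isBounded_cell.measure_lt_top.ne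
  intro h
  have hne : (interior cell).Nonempty := by
    rw [nonempty_iff_ne_empty]
    intro he
    have := closure_interior_cell (show (0 : E3) ∈ cell from fun i => ⟨by simp, by
      simp; positivity⟩)
    simp [he] at this
  exact (isOpen_interior.measure_pos volume hne).ne'
    (measure_mono_null interior_subset h)

/-- `ℂ³` with its Euclidean norm. -/
abbrev C3 : Type := EuclideanSpace ℂ (Fin 3)

lemma integrable_L2 (S : L2Torus) : Integrable S (volume.restrict cell) :=
  (Lp.memLp S).integrable (by norm_num)

/-- The plane wave `x ↦ |cell|^{-1/2} e^{ik·x} e_m`. -/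
noncomputable def wave (q : (Fin 3 → ℤ) × Fin 3) : L2Torus :=
  (memLp_cell (f := fun x => ((√cellVol : ℝ) : ℂ)⁻¹ • chr q.1 x •
    (EuclideanSpace.single q.2 (1 : ℂ) : C3))
    (by have := continuous_chr q.1; fun_prop) 2).toLp _

lemma wave_coe (q : (Fin 3 → ℤ) × Fin 3) : wave q =ᵐ[volume.restrict cell]
    fun x => ((√cellVol : ℝ) : ℂ)⁻¹ • chr q.1 x • (EuclideanSpace.single q.2 (1 : ℂ) : C3) :=
  MemLp.coeFn_toLp _

lemma inner_wave (q : (Fin 3 → ℤ) × Fin 3) (S : L2Torus) :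
    inner ℂ (wave q) S = ((√cellVol : ℝ) : ℂ)⁻¹ * (fc S q.1) q.2 := by
  rw [L2.inner_def]
  have e : (fun x => inner ℂ (wave q x) (S x)) =ᵐ[volume.restrict cell]
      fun x => ((√cellVol : ℝ) : ℂ)⁻¹ * (EuclideanSpace.proj q.2 : C3 →L[ℂ] ℂ) (chr (-q.1) x • S x) := by
    filter_upwards [wave_coe q] with x hx
    rw [hx, inner_smul_left, inner_smul_left, conj_chr, EuclideanSpace.inner_single_left]
    simp
  rw [integral_congr_ae e, integral_const_mul,
    ContinuousLinearMap.integral_comp_comm _ (integrable_chr_smul (integrable_L2 S) _)]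
  rfl

lemma fc_wave (q : (Fin 3 → ℤ) × Fin 3) (k : Fin 3 → ℤ) :
    fc (wave q) k = if k = q.1 then ((√cellVol : ℝ) : ℂ) • EuclideanSpace.single q.2 (1 : ℂ) else 0 := by
  rw [fc_congr_ae (wave_coe q), fc]
  have e : (fun x => chr (-k) x • ((√cellVol : ℝ) : ℂ)⁻¹ • chr q.1 x •
      (EuclideanSpace.single q.2 (1 : ℂ) : C3)) = fun x => chr (q.1 - k) x • (((√cellVol : ℝ) : ℂ)⁻¹ •
      (EuclideanSpace.single q.2 (1 : ℂ) : C3)) := by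
    funext x
    rw [sub_eq_neg_add, ← chr_mul, smul_smul, smul_smul, smul_smul]
    congr 1
    ring
  rw [e, integral_smul_const]
  split_ifs with h
  · rw [h, sub_self]
    simp only [chr_zero, integral_const, measureReal_restrict_apply_univ]
    rw [smul_smul]
    congr 1
    have : (volume : Measure E3).real cell = √cellVol * √cellVol :=
      (Real.mul_self_sqrt cellVol_pos.le).symm
    rw [this]
    have h0 : (√cellVol : ℝ) ≠ 0 := (Real.sqrt_pos.2 cellVol_pos).ne'
    have h1 : ((√cellVol : ℝ) : ℂ) ≠ 0 := by exact_mod_cast h0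
    simp
  · rw [integral_chr (fun h' => h (sub_eq_zero.1 h').symm), zero_smul]

lemma orthonormal_wave : Orthonormal ℂ wave := by
  rw [orthonormal_iff_ite]
  rintro ⟨k, m⟩ ⟨l, n⟩
  rw [inner_wave, fc_wave]
  have h0 : (√cellVol : ℝ) ≠ 0 := (Real.sqrt_pos.2 cellVol_pos).ne'
  have h1 : ((√cellVol : ℝ) : ℂ) ≠ 0 := by exact_mod_cast h0
  by_cases h : k = l
  · by_cases h' : m = n <;> simp [h, h', h1]
  · simp [h]

/-- A square-integrable field whose Fourier coefficients vanish is zero. -/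
theorem L2Torus.eq_zero_of_fc {S : L2Torus} (h : ∀ k, fc S k = 0) : S = 0 := by
  have hm : ∀ m, (fun x => S x m) =ᵐ[volume.restrict cell] 0 := by
    intro m
    refine ae_eq_zero_of_fc_eq_zero
      ((EuclideanSpace.proj m : C3 →L[ℂ] ℂ).comp_memLp' (Lp.memLp S)) fun k => ?_
    have := fc_clm (EuclideanSpace.proj m : C3 →L[ℂ] ℂ) (integrable_L2 S) k
    rw [h k, map_zero] at this
    exact this
  rw [Lp.eq_zero_iff_ae_eq_zero]
  filter_upwards [hm 0, hm 1, hm 2] with x h0 h1 h2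
  ext m
  fin_cases m
  · exact h0
  · exact h1
  · exact h2

/-- The plane waves form a Hilbert basis of `L²(𝕋³; ℂ³)`. -/
noncomputable def waveBasis : HilbertBasis ((Fin 3 → ℤ) × Fin 3) ℂ L2Torus :=
  HilbertBasis.mkOfOrthogonalEqBot orthonormal_wave (by
    rw [Submodule.eq_bot_iff]
    intro S hS
    refine L2Torus.eq_zero_of_fc fun k => ?_
    ext m
    have := (Submodule.mem_orthogonal _ _).1 hS (wave (k, m)) (Submodule.subset_span ⟨_, rfl⟩)
    rw [inner_wave] at this
    have h0 : (√cellVol : ℝ) ≠ 0 := (Real.sqrt_pos.2 cellVol_pos).ne'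
    simpa [h0] using this)

lemma waveBasis_repr (S : L2Torus) (q : (Fin 3 → ℤ) × Fin 3) :
    waveBasis.repr S q = ((√cellVol : ℝ) : ℂ)⁻¹ * (fc S q.1) q.2 := by
  rw [HilbertBasis.repr_apply_apply, waveBasis, HilbertBasis.coe_mkOfOrthogonalEqBot, inner_wave]

lemma fc_add_L2 (S T : L2Torus) (k : Fin 3 → ℤ) :
    fc (S + T : L2Torus) k = fc S k + fc T k := by
  rw [fc_congr_ae (Lp.coeFn_add S T)]
  exact fc_add (integrable_L2 S) (integrable_L2 T) k

lemma fc_sub_L2 (S T : L2Torus) (k : Fin 3 → ℤ) :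
    fc (S - T : L2Torus) k = fc S k - fc T k := by
  rw [eq_sub_iff_add_eq, ← fc_add_L2, sub_add_cancel]

lemma fc_smul_L2 (c : ℂ) (S : L2Torus) (k : Fin 3 → ℤ) :
    fc (c • S : L2Torus) k = c • fc S k := by
  rw [fc_congr_ae (Lp.coeFn_smul c S)]
  exact fc_clm (c • ContinuousLinearMap.id ℂ C3) (integrable_L2 S) k

/-- Reduces identities between `L²` fields and constant-coefficient operators to algebra at each
frequency. -/
theorem L2Torus.ext_fc {S T : L2Torus} (h : ∀ k, fc S k = fc T k) : S = T := by
  rw [← sub_eq_zero]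
  refine L2Torus.eq_zero_of_fc fun k => ?_
  rw [fc_sub_L2, h k, sub_self]

/-! ### Diagonal operators -/

section Diagonal

variable {ι H : Type*} [NormedAddCommGroup H] [InnerProductSpace ℂ H]

lemma memℓp_mul_of_bound {c : ι → ℂ} {C : ℝ} (hc : ∀ i, ‖c i‖ ≤ C)
    (f : lp (fun _ : ι => ℂ) 2) : Memℓp (fun i => c i * f i) 2 := by
  have h : Memℓp (fun i => (C : ℂ) * f i) 2 := (lp.memℓp f).const_mul (C : ℂ)
  rw [memℓp_gen_iff (by norm_num)] at h ⊢
  refine h.of_nonneg_of_le (fun i => by positivity) fun i => ?_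
  have : ‖c i * f i‖ ≤ ‖(C : ℂ) * f i‖ := by
    rw [norm_mul, norm_mul]
    refine mul_le_mul_of_nonneg_right ((hc i).trans ?_) (norm_nonneg _)
    rw [Complex.norm_real]
    exact le_abs_self C
  gcongr

/-- The operator which is diagonal in a Hilbert basis, with bounded coefficients. -/
noncomputable def diagOp (b : HilbertBasis ι ℂ H) (c : ι → ℂ) (C : ℝ) (hc : ∀ i, ‖c i‖ ≤ C) :
    H →L[ℂ] H :=
  LinearMap.mkContinuous
    { toFun := fun x => b.repr.symm ⟨fun i => c i * b.repr x i, memℓp_mul_of_bound hc _⟩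
      map_add' := fun x y => by
        rw [← map_add]
        congr 1
        ext i
        rw [lp.coeFn_add, Pi.add_apply]
        simp [mul_add]
      map_smul' := fun a x => by
        rw [RingHom.id_apply, ← map_smul]
        congr 1
        ext i
        simp [mul_left_comm] } |C| (fun x => by
      simp only [LinearMap.coe_mk, AddHom.coe_mk, LinearIsometryEquiv.norm_map]
      refine lp.norm_le_of_forall_sum_le (by norm_num) (by positivity) fun s => ?_
      have h2 : ∑ i ∈ s, ‖b.repr x i‖ ^ (2 : ℝ≥0∞).toReal ≤ ‖x‖ ^ (2 : ℝ≥0∞).toReal := by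
        rw [← b.repr.norm_map x]
        exact lp.sum_rpow_le_norm_rpow (by norm_num) _ s
      simp only [ENNReal.toReal_ofNat, Real.rpow_two] at h2 ⊢
      calc ∑ i ∈ s, ‖c i * b.repr x i‖ ^ 2 ≤ ∑ i ∈ s, |C| ^ 2 * ‖b.repr x i‖ ^ 2 := by
            refine Finset.sum_le_sum fun i _ => ?_
            rw [norm_mul, mul_pow]
            gcongr
            exact (hc i).trans (le_abs_self C)
        _ ≤ (|C| * ‖x‖) ^ 2 := by
            rw [← Finset.mul_sum, mul_pow]
            gcongr)

lemma repr_diagOp (b : HilbertBasis ι ℂ H) (c : ι → ℂ) (C : ℝ) (hc : ∀ i, ‖c i‖ ≤ C)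
    (x : H) (i : ι) : b.repr (diagOp b c C hc x) i = c i * b.repr x i := by
  simp [diagOp]

lemma norm_diagOp_le (b : HilbertBasis ι ℂ H) (c : ι → ℂ) (C : ℝ) (hC : 0 ≤ C)
    (hc : ∀ i, ‖c i‖ ≤ C) : ‖diagOp b c C hc‖ ≤ C := by
  refine (LinearMap.mkContinuous_norm_le _ (abs_nonneg C) _).trans (abs_of_nonneg hC).le

/-- A diagonal operator whose coefficients tend to zero is compact. -/
theorem isCompactOperator_diagOp [CompleteSpace H] (b : HilbertBasis ι ℂ H) (c : ι → ℂ) (C : ℝ)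
    (hc : ∀ i, ‖c i‖ ≤ C) (h0 : ∀ ε > 0, {i | ε < ‖c i‖}.Finite) :
    IsCompactOperator (diagOp b c C hc) := by
  classical
  have hcl := isClosed_setOfPred_isCompactOperator (σ₁₂ := RingHom.id ℂ) (M₁ := H) (M₂ := H)
  refine hcl.closure_subset_iff.2 subset_rfl (Metric.mem_closure_iff.2 fun ε hε => ?_)
  -- Keeping only the finitely many coefficients larger than `ε / 2` gives a finite-rank operator
  -- `R` within `ε / 2` of the original; compact operators are closed in norm.
  let s := (h0 (ε / 2) (by positivity)).toFinset
  let R : H →L[ℂ] H := ∑ i ∈ s, (ContinuousLinearMap.toSpanSingleton ℂ (c i • b i)).comp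
    (innerSL ℂ (b i))
  have hR : IsCompactOperator R := by
    have hz : IsCompactOperator ((0 : H →L[ℂ] H)) := isCompactOperator_zero
    refine Finset.sum_induction _ (fun T : H →L[ℂ] H => IsCompactOperator T)
      (fun _ _ h h' => h.add h') hz fun i _ => ?_
    exact (isCompactOperator_of_locallyCompactSpace_rng
      (ContinuousLinearMap.toSpanSingleton ℂ (c i • b i))).comp_clm (innerSL ℂ (b i))
  refine ⟨R, hR, ?_⟩
  have hd : ∀ i, ‖if i ∈ s then 0 else c i‖ ≤ ε / 2 := by
    intro i
    split_ifs with hi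
    · simp; positivity
    · simpa [s] using hi
  have e : diagOp b c C hc - R = diagOp b (fun i => if i ∈ s then 0 else c i) (ε / 2) hd := by
    ext x
    refine b.repr.injective ?_
    ext j
    rw [repr_diagOp, sub_apply, map_sub, lp.coeFn_sub, Pi.sub_apply, repr_diagOp]
    have hRj : b.repr (R x) j = if j ∈ s then c j * b.repr x j else 0 := by
      rw [b.repr_apply_apply]
      simp only [R, _root_.sum_apply, ContinuousLinearMap.comp_apply,
        ContinuousLinearMap.toSpanSingleton_apply, innerSL_apply_apply, inner_sum, inner_smul_right,
        orthonormal_iff_ite.1 b.orthonormal]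
      simp [b.repr_apply_apply, mul_comm]
    rw [hRj]
    split_ifs <;> simp
  rw [dist_eq_norm, e]
  exact (norm_diagOp_le b _ _ (by positivity) hd).trans_lt (by linarith)

lemma inner_eq_tsum_repr (b : HilbertBasis ι ℂ H) (x y : H) :
    inner ℂ x y = ∑' i, (starRingEnd ℂ) (b.repr x i) * b.repr y i := by
  rw [← b.repr.inner_map_map, lp.inner_eq_tsum]
  simp [mul_comm]

lemma inner_diagOp_left (b : HilbertBasis ι ℂ H) (c : ι → ℂ) (C : ℝ)
    (hc : ∀ i, ‖c i‖ ≤ C) (hreal : ∀ i, (starRingEnd ℂ) (c i) = c i) (x y : H) :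
    inner ℂ (diagOp b c C hc x) y = inner ℂ x (diagOp b c C hc y) := by
  rw [inner_eq_tsum_repr b, inner_eq_tsum_repr b]
  refine tsum_congr fun i => ?_
  rw [repr_diagOp, repr_diagOp, map_mul, hreal]
  ring

end Diagonal

/-! ### Pointwise cross products -/

/-- The complex-bilinear cross product on `ℂ³`. -/
noncomputable def crossL : C3 →L[ℂ] C3 →L[ℂ] C3 :=
  LinearMap.toContinuousBilinearMap
    (LinearMap.mk₂ ℂ (fun a b => WithLp.toLp 2 (a.ofLp ⨯₃ b.ofLp))
      (fun a b c => by simp) (fun r a b => by simp) (fun a b c => by simp) (fun r a b => by simp))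

lemma crossL_apply (a b : C3) : crossL a b = WithLp.toLp 2 (a.ofLp ⨯₃ b.ofLp) := rfl

/-- Multiplication of square-integrable fields by a bounded field, for the cross product. -/
noncomputable def mult : Lp C3 ⊤ (volume.restrict cell) →L[ℂ] L2Torus →L[ℂ] L2Torus :=
  crossL.holderL (volume.restrict cell) ⊤ 2 2

lemma mult_coe (u : Lp C3 ⊤ (volume.restrict cell)) (S : L2Torus) :
    mult u S =ᵐ[volume.restrict cell] fun x => crossL (u x) (S x) :=
  crossL.coeFn_holder u S

lemma fc_mult_const (v : C3) (S : L2Torus) (k : Fin 3 → ℤ) :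
    fc (mult (Lp.const ⊤ (volume.restrict cell) v) S) k = crossL v (fc S k) := by
  rw [← fc_clm (crossL v) (integrable_L2 S) k]
  refine fc_congr_ae ?_ k
  filter_upwards [mult_coe (Lp.const ⊤ (volume.restrict cell) v) S,
    Lp.coeFn_const (p := ⊤) (μ := volume.restrict cell) v] with x h1 h2
  rw [h1, h2]
  rfl

/-! ### The operator `(-Δ)⁻¹ curl` -/

/-- The multiplier `k_a / |k|²`. -/
noncomputable def kcoef (a : Fin 3) (q : (Fin 3 → ℤ) × Fin 3) : ℂ :=
  (((q.1 a : ℝ) / ∑ i, (q.1 i : ℝ) ^ 2 : ℝ) : ℂ)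

lemma sum_sq_pos {k : Fin 3 → ℤ} (hk : k ≠ 0) : 0 < ∑ i, (k i : ℝ) ^ 2 := by
  obtain ⟨i, hi⟩ : ∃ i, k i ≠ 0 := by
    by_contra h; push Not at h; exact hk (funext h)
  refine Finset.sum_pos' (fun _ _ => by positivity) ⟨i, Finset.mem_univ _, ?_⟩
  have : (k i : ℝ) ≠ 0 := by exact_mod_cast hi
  positivity

/-- `2 |k_a k_j| ≤ k_a² + k_j² ≤ 2 |k|²`. With `j` arbitrary this is decay of order one, the source
of both boundedness and compactness. -/
lemma norm_kcoef_mul_le (a : Fin 3) (q : (Fin 3 → ℤ) × Fin 3) (j : Fin 3) :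
    ‖kcoef a q‖ * |(q.1 j : ℝ)| ≤ 1 := by
  by_cases hk : q.1 = 0
  -- At `k = 0` the multiplier is `0 / 0 = 0`, so constants are annihilated.
  · simp [kcoef, hk]
  have hs := sum_sq_pos hk
  rw [kcoef, Complex.norm_real, Real.norm_eq_abs, abs_div, abs_of_pos hs, div_mul_eq_mul_div,
    div_le_one hs]
  have h1 := Finset.single_le_sum (f := fun i => (q.1 i : ℝ) ^ 2) (fun i _ => sq_nonneg _)
    (Finset.mem_univ a)
  have h2 := Finset.single_le_sum (f := fun i => (q.1 i : ℝ) ^ 2) (fun i _ => sq_nonneg _)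
    (Finset.mem_univ j)
  nlinarith [sq_nonneg (|(q.1 a : ℝ)| - |(q.1 j : ℝ)|), sq_abs (q.1 a : ℝ), sq_abs (q.1 j : ℝ)]

lemma norm_kcoef_le (a : Fin 3) (q : (Fin 3 → ℤ) × Fin 3) : ‖kcoef a q‖ ≤ 1 := by
  by_cases hk : q.1 = 0
  · simp [kcoef, hk]
  obtain ⟨i, hi⟩ : ∃ i, q.1 i ≠ 0 := by
    by_contra h; push Not at h; exact hk (funext h)
  have h1 : (1 : ℝ) ≤ |(q.1 i : ℝ)| := by exact_mod_cast Int.one_le_abs hi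
  have h2 := norm_kcoef_mul_le a q i
  nlinarith [norm_nonneg (kcoef a q)]

/-- By the decay, a multiplier above `ε` forces every coordinate of `k` to be at most `1 / ε`,
leaving finitely many frequencies. -/
lemma kcoef_finite (a : Fin 3) (ε : ℝ) (hε : 0 < ε) : {q | ε < ‖kcoef a q‖}.Finite := by
  obtain ⟨N, hN⟩ := exists_nat_gt (1 / ε)
  have hfin : ((Set.Icc (fun _ => -(N : ℤ)) (fun _ => (N : ℤ)) : Set (Fin 3 → ℤ)) ×ˢ
      (Set.univ : Set (Fin 3))).Finite := (Set.finite_Icc _ _).prod Set.finite_univ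
  refine hfin.subset fun q hq => ⟨?_, Set.mem_univ _⟩
  have hb : ∀ j, |q.1 j| ≤ (N : ℤ) := by
    intro j
    have h := norm_kcoef_mul_le a q j
    have hq' : ε < ‖kcoef a q‖ := hq
    have h1 : |(q.1 j : ℝ)| ≤ 1 / ε := by
      rw [le_div_iff₀ hε]
      nlinarith [abs_nonneg (q.1 j : ℝ)]
    exact_mod_cast h1.trans hN.le
  exact ⟨fun j => (abs_le.1 (hb j)).1, fun j => (abs_le.1 (hb j)).2⟩

/-- The operator with multiplier `k_a / |k|²`. -/
noncomputable def rieszOp (a : Fin 3) : L2Torus →L[ℂ] L2Torus :=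
  diagOp waveBasis (kcoef a) 1 (norm_kcoef_le a)

lemma fc_rieszOp (a : Fin 3) (S : L2Torus) (k : Fin 3 → ℤ) :
    fc (rieszOp a S) k = kcoef a (k, 0) • fc S k := by
  ext m
  have h := repr_diagOp waveBasis (kcoef a) 1 (norm_kcoef_le a) S (k, m)
  rw [waveBasis_repr, waveBasis_repr] at h
  have h0 : (√cellVol : ℝ) ≠ 0 := (Real.sqrt_pos.2 cellVol_pos).ne'
  have h1 : ((√cellVol : ℝ) : ℂ)⁻¹ ≠ 0 := by
    rw [ne_eq, inv_eq_zero]; exact_mod_cast h0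
  rw [mul_left_comm] at h
  exact mul_left_cancel₀ h1 h

/-- A wave vector as an element of `ℂ³`. -/
noncomputable def kvec (k : Fin 3 → ℤ) : C3 := WithLp.toLp 2 fun i => (k i : ℂ)

/-- The operator `(-Δ)⁻¹ curl` on `L²(𝕋³; ℂ³)`. -/
noncomputable def curlInv : L2Torus →L[ℂ] L2Torus :=
  ∑ a, Complex.I • (mult (Lp.const ⊤ (volume.restrict cell) (EuclideanSpace.single a 1))).comp
    (rieszOp a)

lemma fc_sum_L2 {ι : Type*} (s : Finset ι) (f : ι → L2Torus) (k : Fin 3 → ℤ) :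
    fc (∑ a ∈ s, f a : L2Torus) k = ∑ a ∈ s, fc (f a) k := by
  classical
  induction s using Finset.induction_on with
  | empty =>
    simp only [Finset.sum_empty]
    have := fc_smul_L2 0 0 k
    simpa using this
  | insert a s ha ih => rw [Finset.sum_insert ha, Finset.sum_insert ha, fc_add_L2, ih]

/-- The symbol `i k × / |k|²`. At `k = 0` it is zero, so the range consists of mean-free fields, as
the cell problem demands. -/
theorem fc_curlInv (F : L2Torus) (k : Fin 3 → ℤ) :
    fc (curlInv F) k = (Complex.I / ∑ i, (k i : ℂ) ^ 2) • crossL (kvec k) (fc F k) := by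
  have e : curlInv F = ∑ a, Complex.I •
      mult (Lp.const ⊤ (volume.restrict cell) (EuclideanSpace.single a 1)) (rieszOp a F) := by
    simp [curlInv]
  rw [e, fc_sum_L2]
  simp only [fc_smul_L2, fc_mult_const, fc_rieszOp, map_smul]
  have h : kvec k = ∑ a, (k a : ℂ) • EuclideanSpace.single a (1 : ℂ) := by
    ext i
    simp [kvec, Pi.single_apply]
  rw [h, map_sum, _root_.sum_apply, Finset.smul_sum]
  refine Finset.sum_congr rfl fun a _ => ?_
  rw [map_smul, smul_apply, smul_smul, smul_smul]
  congr 1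
  simp [kcoef]
  ring

/-- Each summand is a multiplier tending to zero followed by a bounded cross product. -/
theorem isCompactOperator_curlInv : IsCompactOperator curlInv := by
  refine Finset.sum_induction _ (fun T : L2Torus →L[ℂ] L2Torus => IsCompactOperator T)
      (fun _ _ h h' => h.add h') isCompactOperator_zero fun a _ => ?_
  exact ((isCompactOperator_diagOp waveBasis (kcoef a) 1 (norm_kcoef_le a)
    (fun ε hε => kcoef_finite a ε hε)).clm_comp
    (mult (Lp.const ⊤ (volume.restrict cell) (EuclideanSpace.single a 1)))).smul Complex.I

/-- The cross product with a vector is antisymmetric for the bilinear product; it is also skew for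
the Hermitian one because the unit vector is real. -/
lemma inner_mult_const_left (a : Fin 3) (F G : L2Torus) :
    inner ℂ (mult (Lp.const ⊤ (volume.restrict cell) (EuclideanSpace.single a 1)) F) G
      = - inner ℂ F (mult (Lp.const ⊤ (volume.restrict cell) (EuclideanSpace.single a 1)) G) := by
  rw [L2.inner_def, L2.inner_def, ← integral_neg]
  refine integral_congr_ae ?_
  filter_upwards [mult_coe (Lp.const ⊤ (volume.restrict cell) (EuclideanSpace.single a 1)) F,
    mult_coe (Lp.const ⊤ (volume.restrict cell) (EuclideanSpace.single a 1)) G,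
    Lp.coeFn_const (p := ⊤) (μ := volume.restrict cell) (EuclideanSpace.single a (1 : ℂ))]
    with x h1 h2 h3
  rw [h1, h2, h3]
  simp only [crossL_apply, PiLp.inner_apply, Fin.sum_univ_three, Function.const_apply]
  fin_cases a <;> simp [cross_apply]

/-- `(-Δ)⁻¹ curl` is self-adjoint. -/
theorem inner_curlInv_left (F G : L2Torus) :
    inner ℂ (curlInv F) G = inner ℂ F (curlInv G) := by
  have hcomm : ∀ a, rieszOp a (mult (Lp.const ⊤ (volume.restrict cell)
      (EuclideanSpace.single a 1)) G) = mult (Lp.const ⊤ (volume.restrict cell)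
      (EuclideanSpace.single a 1)) (rieszOp a G) := by
    intro a
    refine L2Torus.ext_fc fun k => ?_
    rw [fc_rieszOp, fc_mult_const, fc_mult_const, fc_rieszOp, map_smul]
  simp only [curlInv, _root_.sum_apply, smul_apply, ContinuousLinearMap.comp_apply,
    sum_inner, inner_sum, inner_smul_left, inner_smul_right, inner_mult_const_left]
  -- The sign from skewness of the cross product cancels the sign from conjugating `i`; the
  -- multiplier is real, and it commutes with the constant cross product by `hcomm`.
  refine Finset.sum_congr rfl fun a _ => ?_
  rw [← hcomm a, rieszOp, inner_diagOp_left _ _ _ _ (fun q => by rw [kcoef, Complex.conj_ofReal])]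
  simp

/-- A square-integrable field is real if its Fourier coefficients are Hermitian. -/
def IsRealField (S : L2Torus) : Prop := ∀ k m, fc S (-k) m = (starRingEnd ℂ) (fc S k m)

/-- Replacing `k` by `-k` conjugates the symbol `i k × / |k|²`. -/
lemma IsRealField.curlInv {S : L2Torus} (h : IsRealField S) : IsRealField (curlInv S) := by
  intro k m
  rw [fc_curlInv, fc_curlInv]
  have hk : kvec (-k) = - kvec k := by ext i; simp [kvec]
  have hreal : ∀ i, (starRingEnd ℂ) (kvec k i) = kvec k i := by simp [kvec]
  rw [hk]
  fin_cases m <;> simp [crossL_apply, cross_apply, h k, hreal] <;> ring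

/-- The inner product of real fields is real. -/
lemma IsRealField.conj_inner {S T : L2Torus} (hS : IsRealField S) (hT : IsRealField T) :
    (starRingEnd ℂ) (inner ℂ S T) = inner ℂ S T := by
  rw [inner_eq_tsum_repr waveBasis, Complex.conj_tsum]
  -- In Parseval's sum, conjugation acts as the reindexing `k ↦ -k`.
  rw [← ((Equiv.neg (Fin 3 → ℤ)).prodCongr (Equiv.refl (Fin 3))).tsum_eq]
  refine tsum_congr fun q => ?_
  simp only [waveBasis_repr, Equiv.prodCongr_apply, Equiv.neg_apply, Prod.map, Equiv.refl_apply,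
    hS q.1, hT q.1, map_mul, map_inv₀, Complex.conj_conj, Complex.conj_ofReal]

/-! ### Fourier coefficients of curl and Laplacian -/

/-- The cross product with the `a`-th unit vector on `Fin 3 → ℂ`. -/
noncomputable def crossUnit (a : Fin 3) : (Fin 3 → ℂ) →L[ℂ] (Fin 3 → ℂ) :=
  LinearMap.toContinuousLinearMap (crossProduct (Pi.single a (1 : ℂ)))

lemma crossUnit_apply (a : Fin 3) (w : Fin 3 → ℂ) :
    crossUnit a w = (Pi.single a (1 : ℂ)) ⨯₃ w := rfl

lemma curl_eq_sum (φ : E3 → Fin 3 → ℂ) (x : E3) :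
    curl φ x = ∑ a, crossUnit a (pd a φ x) := by
  ext m
  fin_cases m <;> simp [curl, Fin.sum_univ_three, crossUnit_apply, cross_apply]

lemma sum_crossUnit (k : Fin 3 → ℂ) (w : Fin 3 → ℂ) :
    ∑ a, k a • crossUnit a w = k ⨯₃ w := by
  ext m
  fin_cases m <;> simp [Fin.sum_univ_three, crossUnit_apply, cross_apply] <;> ring

lemma continuous_curl {φ : E3 → Fin 3 → ℂ} (hφ : ContDiff ℝ 1 φ) : Continuous (curl φ) := by
  have : curl φ = fun x => ∑ a, crossUnit a (pd a φ x) := funext (curl_eq_sum φ)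
  rw [this]
  exact continuous_finsetSum _ fun a _ => (crossUnit a).continuous.comp (continuous_pd hφ a)

lemma continuous_vecLaplacian {φ : E3 → Fin 3 → ℂ} (hφ : ContDiff ℝ ∞ φ) :
    Continuous (vecLaplacian φ) := by
  have : vecLaplacian φ = fun x => ∑ a, pd a (pd a φ) x := rfl
  rw [this]
  exact continuous_finsetSum _ fun a _ =>
    (ContDiff.pd_infty (ContDiff.pd_infty hφ a) a).continuous

lemma fc_finset_sum {F ι : Type*} [NormedAddCommGroup F] [NormedSpace ℂ F] (s : Finset ι)
    (f : ι → E3 → F) (hf : ∀ a ∈ s, Integrable (f a) (volume.restrict cell)) (k : Fin 3 → ℤ) :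
    fc (fun x => ∑ a ∈ s, f a x) k = ∑ a ∈ s, fc (f a) k := by
  simp only [fc, Finset.smul_sum]
  exact integral_finsetSum _ fun a ha => integrable_chr_smul (hf a ha) _

lemma fc_curl {φ : E3 → Fin 3 → ℂ} (hφ : ContDiff ℝ ∞ φ) (hp : IsPeriodic φ) (k : Fin 3 → ℤ) :
    fc (curl φ) k = (fun a => Complex.I * k a) ⨯₃ fc φ k := by
  have h1 : ContDiff ℝ 1 φ := hφ.of_le (by simp)
  rw [show curl φ = fun x => ∑ a, crossUnit a (pd a φ x) from funext (curl_eq_sum φ),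
    fc_finset_sum, ← sum_crossUnit]
  · refine Finset.sum_congr rfl fun a _ => ?_
    rw [fc_clm (crossUnit a) (integrable_cell (continuous_pd h1 a)), fc_pd h1 hp, map_smul]
  · exact fun a _ => integrable_cell ((crossUnit a).continuous.comp (continuous_pd h1 a))

lemma fc_vecLaplacian {φ : E3 → Fin 3 → ℂ} (hφ : ContDiff ℝ ∞ φ) (hp : IsPeriodic φ)
    (k : Fin 3 → ℤ) : fc (vecLaplacian φ) k = -(∑ a, (k a : ℂ) ^ 2) • fc φ k := by
  rw [show vecLaplacian φ = fun x => ∑ a, pd a (pd a φ) x from rfl, fc_finset_sum,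
    ← Finset.sum_neg_distrib, Finset.sum_smul]
  · refine Finset.sum_congr rfl fun a _ => ?_
    rw [fc_pd ((ContDiff.pd_infty hφ a).of_le (by simp)) (hp.pd a), fc_pd (hφ.of_le (by simp)) hp,
      smul_smul]
    congr 1
    ring_nf
    simp
  · exact fun a _ => integrable_cell (ContDiff.pd_infty (ContDiff.pd_infty hφ a) a).continuous

/-! ### Bilinear pairings -/

/-- The conjugate of a continuous field, as an element of `L²`. -/
noncomputable def conjField (ψ : E3 → Fin 3 → ℂ) (hψ : Continuous ψ) : L2Torus :=
  (memLp_cell (f := fun x => (WithLp.toLp 2 fun m => (starRingEnd ℂ) (ψ x m) : C3))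
    (by fun_prop) 2).toLp _

lemma conjField_coe (ψ : E3 → Fin 3 → ℂ) (hψ : Continuous ψ) :
    conjField ψ hψ =ᵐ[volume.restrict cell]
      fun x => (WithLp.toLp 2 fun m => (starRingEnd ℂ) (ψ x m) : C3) :=
  MemLp.coeFn_toLp _

/-- The weak formulation uses the bilinear pairing. Conjugating the test field turns it into the
inner product of `L²`, where self-adjointness and Fourier coefficients apply. -/
lemma inner_conjField (ψ : E3 → Fin 3 → ℂ) (hψ : Continuous ψ) (F : L2Torus) :
    inner ℂ (conjField ψ hψ) F = ∫ x in cell, (F x).ofLp ⬝ᵥ ψ x := by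
  rw [L2.inner_def]
  refine integral_congr_ae ?_
  filter_upwards [conjField_coe ψ hψ] with x hx
  rw [hx]
  simp [PiLp.inner_apply, dotProduct]

lemma integrable_dot (ψ : E3 → Fin 3 → ℂ) (hψ : Continuous ψ) (F : L2Torus) :
    Integrable (fun x => (F x).ofLp ⬝ᵥ ψ x) (volume.restrict cell) := by
  refine (L2.integrable_inner (𝕜 := ℂ) (conjField ψ hψ) F).congr ?_
  filter_upwards [conjField_coe ψ hψ] with x hx
  rw [hx]
  simp [PiLp.inner_apply, dotProduct]

lemma fc_comp {ψ : E3 → Fin 3 → ℂ} (hψ : Continuous ψ) (k : Fin 3 → ℤ) (m : Fin 3) :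
    fc ψ k m = fc (fun x => ψ x m) k :=
  (fc_clm (ContinuousLinearMap.proj (R := ℂ) (φ := fun _ : Fin 3 => ℂ) m)
    (integrable_cell hψ) k).symm

lemma fc_comp_C3 {f : E3 → C3} (hf : Integrable f (volume.restrict cell)) (k : Fin 3 → ℤ)
    (m : Fin 3) : fc f k m = fc (fun x => f x m) k :=
  (fc_clm (EuclideanSpace.proj m : C3 →L[ℂ] ℂ) hf k).symm

lemma fc_conj (f : E3 → ℂ) (k : Fin 3 → ℤ) :
    fc (fun x => (starRingEnd ℂ) (f x)) k = (starRingEnd ℂ) (fc f (-k)) := by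
  rw [fc, fc, ← integral_conj]
  refine integral_congr_ae (Filter.Eventually.of_forall fun x => ?_)
  simp [conj_chr]

lemma fc_conjField (ψ : E3 → Fin 3 → ℂ) (hψ : Continuous ψ) (k : Fin 3 → ℤ) (m : Fin 3) :
    fc (conjField ψ hψ) k m = (starRingEnd ℂ) (fc ψ (-k) m) := by
  rw [fc_congr_ae (conjField_coe ψ hψ), fc_comp_C3, fc_comp hψ, ← fc_conj]
  exact integrable_cell (by fun_prop)

/-- `(-Δ)⁻¹ curl` in weak form. -/
theorem integral_curl_add_laplacian {φ : E3 → Fin 3 → ℂ} (hφ : ContDiff ℝ ∞ φ)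
    (hp : IsPeriodic φ) (G : L2Torus) :
    ∫ x in cell, ((G x).ofLp ⬝ᵥ curl φ x + (curlInv G x).ofLp ⬝ᵥ vecLaplacian φ x) = 0 := by
  have h1 : ContDiff ℝ 1 φ := hφ.of_le (by simp)
  have c1 := continuous_curl h1
  have c2 := continuous_vecLaplacian hφ
  -- Self-adjointness moves `curlInv` onto the test field, after which `curl φ + (-Δ)⁻¹ curl Δφ = 0`
  -- (up to conjugation) is checked on Fourier coefficients.
  rw [integral_add (integrable_dot _ c1 G) (integrable_dot _ c2 _), ← inner_conjField _ c1,
    ← inner_conjField _ c2, ← inner_curlInv_left, ← inner_add_left]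
  convert inner_zero_left G
  refine L2Torus.eq_zero_of_fc fun k => ?_
  rw [fc_add_L2, fc_curlInv]
  have e1 : fc (conjField _ c1) k = WithLp.toLp 2 fun m =>
      (starRingEnd ℂ) (((fun a => Complex.I * ((-k) a : ℤ)) ⨯₃ fc φ (-k)) m) := by
    ext m; rw [fc_conjField, fc_curl hφ hp]
  have e2 : fc (conjField _ c2) k = WithLp.toLp 2 fun m =>
      (starRingEnd ℂ) ((-(∑ a, (((-k) a : ℤ) : ℂ) ^ 2) • fc φ (-k)) m) := by
    ext m; rw [fc_conjField, fc_vecLaplacian hφ hp]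
  rw [e1, e2]
  by_cases hk : k = 0
  · subst hk
    ext m
    fin_cases m <;> simp [cross_apply]
  have hs : (∑ a, (k a : ℂ) ^ 2) ≠ 0 := by
    have := (sum_sq_pos hk).ne'
    exact_mod_cast this
  have e3 : (∑ a, (((-k) a : ℤ) : ℂ) ^ 2) = ∑ a, (k a : ℂ) ^ 2 := by simp
  have e4 : (starRingEnd ℂ) (∑ a, (k a : ℂ) ^ 2) = ∑ a, (k a : ℂ) ^ 2 := by simp
  rw [e3]
  generalize (∑ a, (k a : ℂ) ^ 2) = s at *
  generalize fc φ (-k) = p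
  ext m
  fin_cases m <;> simp [cross_apply, crossL_apply, kvec, e4] <;> field_simp <;> ring

/-- The weak form characterizes `(-Δ)⁻¹ curl`. -/
theorem eq_curlInv_of_weak {S G : L2Torus} (h0 : ∫ x in cell, S x = 0)
    (h : ∀ φ : E3 → Fin 3 → ℂ, ContDiff ℝ ∞ φ → IsPeriodic φ →
      ∫ x in cell, ((G x).ofLp ⬝ᵥ curl φ x + (S x).ofLp ⬝ᵥ vecLaplacian φ x) = 0) :
    S = curlInv G := by
  refine L2Torus.ext_fc fun k => ?_
  rw [fc_curlInv]
  by_cases hk : k = 0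
  -- The equation carries no information at `k = 0`; the mean-zero condition settles that frequency.
  · subst hk
    rw [fc_zero_eq, h0]
    simp
  have hs : (∑ a, (k a : ℂ) ^ 2) ≠ 0 := by
    have := (sum_sq_pos hk).ne'
    exact_mod_cast this
  -- Testing with `e^{-ik·x} e_m` isolates component `m` of the equation at frequency `k`.
  have key : ∀ m : Fin 3, (((fun a => Complex.I * ((-k) a : ℤ)) ⨯₃ (Pi.single m (1 : ℂ))) ⬝ᵥ
      (fc G k).ofLp) - (∑ a, (k a : ℂ) ^ 2) * fc S k m = 0 := by
    intro m
    let φ : E3 → Fin 3 → ℂ := fun x => chr (-k) x • Pi.single m (1 : ℂ)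
    have hφ : ContDiff ℝ ∞ φ := (contDiff_chr _).smul contDiff_const
    have hp : IsPeriodic φ := fun i x => by simp only [φ, periodic_chr (-k) i x]
    have hpd : ∀ i (w : Fin 3 → ℂ) x, pd i (fun x => chr (-k) x • w) x
        = (Complex.I * ((-k) i : ℤ)) • chr (-k) x • w := by
      intro i w x
      have hd := ((contDiff_chr (-k) (n := 1)).differentiable one_ne_zero x).hasFDerivAt.smul_const w
      have h2 := pd_chr (-k) i x
      rw [pd] at h2
      rw [pd]
      erw [hd.fderiv]
      rw [ContinuousLinearMap.smulRight_apply, h2, smul_smul]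
    have hcurl : ∀ x, curl φ x = chr (-k) x •
        ((fun a => Complex.I * ((-k) a : ℤ)) ⨯₃ (Pi.single m (1 : ℂ))) := by
      intro x
      rw [curl_eq_sum, ← sum_crossUnit, Finset.smul_sum]
      refine Finset.sum_congr rfl fun a _ => ?_
      rw [hpd, map_smul, map_smul, smul_comm]
    have hlap : ∀ x, vecLaplacian φ x = chr (-k) x • (-(∑ a, (k a : ℂ) ^ 2)) •
        Pi.single m (1 : ℂ) := by
      intro x
      have h1 : ∀ i, pd i φ = fun x => chr (-k) x • (Complex.I * ((-k) i : ℤ)) •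
          Pi.single m (1 : ℂ) := by
        intro i; funext x
        rw [hpd, smul_comm]
      rw [vecLaplacian]
      simp only [h1, hpd]
      rw [← Finset.sum_neg_distrib, Finset.sum_smul, Finset.smul_sum]
      refine Finset.sum_congr rfl fun a _ => ?_
      rw [smul_comm, smul_smul (Complex.I * _)]
      congr 2
      simp
      ring_nf
      simp
    have hφ' := h φ hφ hp
    have hdot : ∀ (F : L2Torus) (w : Fin 3 → ℂ),
        ∫ x in cell, (F x).ofLp ⬝ᵥ (chr (-k) x • w) = w ⬝ᵥ (fc F k).ofLp := by
      intro F w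
      let L : C3 →L[ℂ] ℂ := ∑ a, w a • (EuclideanSpace.proj a : C3 →L[ℂ] ℂ)
      have hL : ∀ z : C3, L z = w ⬝ᵥ z.ofLp := by
        intro z; simp [L, dotProduct, _root_.sum_apply]
      rw [← hL, fc, ← L.integral_comp_comm (integrable_chr_smul (integrable_L2 F) _)]
      refine integral_congr_ae (Filter.Eventually.of_forall fun x => ?_)
      simp only [hL, dotProduct_smul, WithLp.ofLp_smul]
      rw [dotProduct_comm]
    rw [integral_add (integrable_dot _ (continuous_curl (hφ.of_le (by simp))) G)
      (integrable_dot _ (continuous_vecLaplacian hφ) S)] at hφ'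
    simp only [hcurl, hlap, hdot] at hφ'
    rw [← hφ']
    simp
    ring
  ext m
  have hm := key m
  rw [sub_eq_zero] at hm
  rw [PiLp.smul_apply, smul_eq_mul, div_mul_eq_mul_div, eq_div_iff hs, mul_comm, ← hm]
  fin_cases m <;> simp [cross_apply, crossL_apply, kvec, dotProduct, Fin.sum_univ_three] <;> ring

/-! ### Fields as bounded multipliers -/

/-- A real vector as an element of `C3`. -/
noncomputable def cplxC3 (u : E3) : C3 := WithLp.toLp 2 (cplx u)

lemma norm_cplxC3 (u : E3) : ‖cplxC3 u‖ = ‖u‖ := by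
  simp [EuclideanSpace.norm_eq, cplxC3, cplx]

lemma continuous_cplxC3 : Continuous cplxC3 := by
  unfold cplxC3 cplx
  fun_prop

lemma HDiv.memLp_top (U : HDiv) :
    MemLp (fun x => cplxC3 (U.field x)) ⊤ (volume.restrict cell) :=
  memLp_cell (continuous_cplxC3.comp U.contDiff.continuous) ⊤

/-- A smooth field as a bounded complex field. -/
noncomputable def HDiv.linf (U : HDiv) : Lp C3 ⊤ (volume.restrict cell) := U.memLp_top.toLp _

lemma HDiv.linf_coe (U : HDiv) :
    U.linf =ᵐ[volume.restrict cell] fun x => cplxC3 (U.field x) := MemLp.coeFn_toLp _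

lemma HDiv.linf_add (U V : HDiv) : (U + V).linf = U.linf + V.linf := by
  refine Lp.ext ?_
  filter_upwards [U.linf_coe, V.linf_coe, (U + V).linf_coe, Lp.coeFn_add U.linf V.linf]
    with x h1 h2 h3 h4
  rw [h3, h4, Pi.add_apply, h1, h2, HDiv.field_add]
  ext i
  simp [cplxC3, cplx]

lemma HDiv.linf_smul (c : ℝ) (U : HDiv) : (c • U).linf = (c : ℂ) • U.linf := by
  refine Lp.ext ?_
  filter_upwards [U.linf_coe, (c • U).linf_coe, Lp.coeFn_smul (c : ℂ) U.linf]
    with x h1 h3 h4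
  rw [h3, h4, Pi.smul_apply, h1, HDiv.field_smul]
  ext i
  simp [cplxC3, cplx]

lemma HDiv.linf_sub (U V : HDiv) : (U - V).linf = U.linf - V.linf := by
  rw [eq_sub_iff_add_eq, ← HDiv.linf_add, sub_add_cancel]

lemma HDiv.norm_linf_le (U : HDiv) {C : ℝ} (hC : 0 ≤ C) (h : ∀ x, ‖U.field x‖ ≤ C) :
    ‖U.linf‖ ≤ C := by
  rw [HDiv.linf, Lp.norm_toLp]
  refine ENNReal.toReal_le_of_le_ofReal hC ?_
  rw [eLpNorm_exponent_top]
  refine eLpNormEssSup_le_of_ae_bound (Filter.Eventually.of_forall fun x => ?_)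
  rw [norm_cplxC3]
  exact h x

/-! ### The cell problem as a fixed-point equation -/

/-- Constant fields in `L²`. -/
noncomputable def constField : C3 →L[ℂ] L2Torus := Lp.constL 2 (volume.restrict cell) ℂ

lemma constField_coe (v : C3) : constField v =ᵐ[volume.restrict cell] fun _ => v :=
  Lp.coeFn_const (p := 2) (μ := volume.restrict cell) v

/-- The compact operator `S ↦ (-Δ)⁻¹ curl (u × S)`. -/
noncomputable def cellOp (u : Lp C3 ⊤ (volume.restrict cell)) : L2Torus →L[ℂ] L2Torus :=
  curlInv.comp (mult u)

lemma isCompactOperator_cellOp (u : Lp C3 ⊤ (volume.restrict cell)) :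
    IsCompactOperator (cellOp u) := isCompactOperator_curlInv.comp_clm (mult u)

lemma continuous_cellOp : Continuous cellOp := by unfold cellOp; fun_prop

lemma mult_linf_coe (U : HDiv) (S : L2Torus) : mult U.linf S =ᵐ[volume.restrict cell]
    fun x => WithLp.toLp 2 (cplx (U.field x) ⨯₃ (S x).ofLp) := by
  filter_upwards [mult_coe U.linf S, U.linf_coe] with x h1 h2
  rw [h1, h2]
  rfl

/-- Moving `v × U = -U × v` to the left turns the equation into `S = (-Δ)⁻¹ curl (U × (S + v))`; the
mean of `S` is then automatically zero. -/
theorem isCellSolution_iff (U : HDiv) (v : Fin 3 → ℂ) (S : L2Torus) :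
    IsCellSolution U.field v S ↔
      (1 - cellOp U.linf) S = cellOp U.linf (constField (WithLp.toLp 2 v)) := by
  have hT : (1 - cellOp U.linf) S = cellOp U.linf (constField (WithLp.toLp 2 v)) ↔
      S = curlInv (mult U.linf (S + constField (WithLp.toLp 2 v))) := by
    rw [sub_apply, one_apply_eq_self, sub_eq_iff_eq_add, map_add, map_add, add_comm]
    rfl
  rw [hT]
  set G : L2Torus := mult U.linf (S + constField (WithLp.toLp 2 v)) with hG
  have hGc : G =ᵐ[volume.restrict cell] fun x =>
      WithLp.toLp 2 (cplx (U.field x) ⨯₃ (S x).ofLp - v ⨯₃ cplx (U.field x)) := by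
    filter_upwards [mult_linf_coe U (S + constField (WithLp.toLp 2 v)),
      Lp.coeFn_add S (constField (WithLp.toLp 2 v)), constField_coe (WithLp.toLp 2 v)]
      with x h1 h2 h3
    rw [hG, h1, h2, Pi.add_apply, h3]
    simp [sub_eq_add_neg]
  have heq : ∀ φ : E3 → Fin 3 → ℂ, ContDiff ℝ ∞ φ → IsPeriodic φ →
      ((∫ x in cell, ((cplx (U.field x) ⨯₃ (S x).ofLp) ⬝ᵥ curl φ x +
          (S x).ofLp ⬝ᵥ vecLaplacian φ x)
        = ∫ x in cell, (v ⨯₃ cplx (U.field x)) ⬝ᵥ curl φ x) ↔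
      ∫ x in cell, ((G x).ofLp ⬝ᵥ curl φ x + (S x).ofLp ⬝ᵥ vecLaplacian φ x) = 0) := by
    intro φ hφ hp
    have c1 := continuous_curl (φ := φ) (hφ.of_le (by simp))
    have c2 := continuous_vecLaplacian hφ
    have i1 : Integrable (fun x => (cplx (U.field x) ⨯₃ (S x).ofLp) ⬝ᵥ curl φ x +
          (S x).ofLp ⬝ᵥ vecLaplacian φ x) (volume.restrict cell) := by
      refine Integrable.add ?_ (integrable_dot _ c2 S)
      refine (integrable_dot _ c1 (mult U.linf S)).congr ?_
      filter_upwards [mult_linf_coe U S] with x hx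
      rw [hx]
    have i2 : Integrable (fun x => (v ⨯₃ cplx (U.field x)) ⬝ᵥ curl φ x)
        (volume.restrict cell) := by
      refine integrable_cell ?_
      have h3 : Continuous fun x => (crossL (WithLp.toLp 2 v)) (cplxC3 (U.field x)) :=
        (crossL (WithLp.toLp 2 v)).continuous.comp
          (continuous_cplxC3.comp U.contDiff.continuous)
      have h4 : Continuous fun x => v ⨯₃ cplx (U.field x) :=
        (PiLp.continuous_ofLp 2 _).comp h3
      exact h4.dotProduct c1
    rw [← sub_eq_zero, ← integral_sub i1 i2]
    refine Eq.congr_left (integral_congr_ae ?_)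
    filter_upwards [hGc] with x hx
    rw [hx]
    simp only [sub_dotProduct]
    ring
  constructor
  · rintro ⟨h0, h⟩
    exact eq_curlInv_of_weak h0 fun φ hφ hp => (heq φ hφ hp).1 (h φ hφ hp)
  · intro hS
    refine ⟨?_, fun φ hφ hp => (heq φ hφ hp).2 ?_⟩
    · rw [← fc_zero_eq, hS, fc_curlInv]
      simp
    · have := integral_curl_add_laplacian hφ hp G
      rwa [← hS] at this

/-- If the cell problem has unique solutions, then `1 - cellOp` is invertible. -/
theorem isUnit_of_isSolutionMap {U : HDiv} {𝒮 : (Fin 3 → ℂ) → L2Torus}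
    (h : IsSolutionMap U.field 𝒮) : IsUnit (1 - cellOp U.linf) := by
  -- Uniqueness for `v = 0` says that the kernel is trivial.
  have hker : ∀ S : L2Torus, (1 - cellOp U.linf) S = 0 → S = 0 := by
    intro S hS
    have h1 : IsCellSolution U.field 0 S := by
      rw [isCellSolution_iff, hS]; simp
    have h2 : IsCellSolution U.field 0 0 := by
      rw [isCellSolution_iff]; simp
    rw [(h 0 S).1 h1, ← (h 0 0).1 h2]
  -- Fredholm alternative: for a compact operator, `1` is an eigenvalue or lies in the resolvent
  -- set.
  rcases (isCompactOperator_cellOp U.linf).hasEigenvalue_or_mem_resolventSet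
    (one_ne_zero (α := ℂ)) with h1 | h1
  · obtain ⟨S, hS⟩ := h1.exists_hasEigenvector
    refine absurd (hker S ?_) hS.2
    have := hS.apply_eq_smul
    rw [one_smul] at this
    rw [sub_apply, one_apply_eq_self, sub_eq_zero]
    exact this.symm
  · simpa [spectrum.mem_resolventSet_iff] using h1

/-- The solution operator of the cell problem. -/
noncomputable def solOp (w u : Lp C3 ⊤ (volume.restrict cell)) : C3 →L[ℂ] L2Torus :=
  (Ring.inverse (1 - cellOp w)).comp ((cellOp u).comp constField)

theorem isSolutionMap_of_isUnit {U : HDiv} (h : IsUnit (1 - cellOp U.linf)) :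
    IsSolutionMap U.field fun v => solOp U.linf U.linf (WithLp.toLp 2 v) := by
  intro v S
  rw [isCellSolution_iff]
  constructor
  · intro hS
    beta_reduce
    rw [solOp, ContinuousLinearMap.comp_apply, ContinuousLinearMap.comp_apply, ← hS]
    exact (congrArg (fun T : L2Torus →L[ℂ] L2Torus => T S) (Ring.inverse_mul_cancel _ h)).symm
  · rintro rfl
    beta_reduce
    rw [solOp, ContinuousLinearMap.comp_apply]
    exact congrArg (fun T : L2Torus →L[ℂ] L2Torus => T _) (Ring.mul_inverse_cancel _ h)

/-! ### The alpha-matrix -/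

/-- The mean of a field. -/
noncomputable def avgL : L2Torus →L[ℂ] C3 :=
  -- The inner product with `wave (0, m)` is `|cell|^{-1/2} ∫ S_m`, which the prefactor turns into
  -- the mean.
  ∑ m, ((((cellVol⁻¹ * √cellVol : ℝ) : ℂ)) • innerSL ℂ (wave (0, m))).smulRight
    (EuclideanSpace.single m (1 : ℂ))

lemma avgL_apply (S : L2Torus) : avgL S = ((cellVol⁻¹ : ℝ) : ℂ) • ∫ x in cell, S x := by
  rw [← fc_zero_eq]
  have h0 : ((√cellVol : ℝ) : ℂ) ≠ 0 := by
    exact_mod_cast (Real.sqrt_pos.2 cellVol_pos).ne'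
  have hV : ((cellVol : ℝ) : ℂ) ≠ 0 := by exact_mod_cast cellVol_pos.ne'
  ext m
  rw [avgL, _root_.sum_apply]
  simp [inner_wave, Pi.single_apply]
  field_simp

lemma setAverage_eq_avgL (U : HDiv) (S : L2Torus) :
    (⨍ x in cell, cplx (U.field x) ⨯₃ (S x).ofLp) = (avgL (mult U.linf S)).ofLp := by
  have h1 : ∫ x in cell, cplx (U.field x) ⨯₃ (S x).ofLp
      = (∫ x in cell, mult U.linf S x).ofLp := by
    have h2 := (EuclideanSpace.equiv (Fin 3) ℂ).toContinuousLinearMap.integral_comp_comm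
      (integrable_L2 (mult U.linf S))
    refine Eq.trans (integral_congr_ae ?_) h2
    filter_upwards [mult_linf_coe U S] with x hx
    rw [hx]
    rfl
  rw [setAverage_eq, h1, avgL_apply]
  ext m
  simp [cellVol]

/-- The response operator `v ↦ ⨍ u × S`, where `S` solves the cell problem for `w` with the
source term of `u`. -/
noncomputable def respOp (w u : Lp C3 ⊤ (volume.restrict cell)) : C3 →L[ℂ] C3 :=
  (avgL.comp (mult u)).comp (solOp w u)

/-- The matrix of a linear operator on `ℂ³`. -/
noncomputable def matOf (T : C3 →L[ℂ] C3) : Matrix (Fin 3) (Fin 3) ℂ :=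
  fun a b => T (EuclideanSpace.single b 1) a

lemma matOf_mulVec (T : C3 →L[ℂ] C3) (v : Fin 3 → ℂ) :
    matOf T *ᵥ v = (T (WithLp.toLp 2 v)).ofLp := by
  have h : (WithLp.toLp 2 v : C3) = ∑ b, v b • EuclideanSpace.single b (1 : ℂ) := by
    ext i
    simp [Pi.single_apply]
  rw [h, map_sum]
  ext a
  simp [matOf, Matrix.mulVec, dotProduct, mul_comm]

lemma continuous_matOf : Continuous matOf := by
  refine continuous_matrix fun a b => ?_
  unfold matOf
  fun_prop

/-- The matrix of the cross product with a vector. -/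
def crossMat (a : Fin 3 → ℂ) : Matrix (Fin 3) (Fin 3) ℂ :=
  !![0, -a 2, a 1; a 2, 0, -a 0; -a 1, a 0, 0]

lemma crossMat_mulVec (a v : Fin 3 → ℂ) : crossMat a *ᵥ v = a ⨯₃ v := by
  ext i
  fin_cases i <;> simp [crossMat, cross_apply, Matrix.mulVec, dotProduct, Fin.sum_univ_three] <;>
    ring

/-- The alpha-matrix. -/
noncomputable def alphaMat (w u : Lp C3 ⊤ (volume.restrict cell)) (j : E3) :
    Matrix (Fin 3) (Fin 3) ℂ :=
  Complex.I • (crossMat (cplx (‖j‖⁻¹ • j)) * matOf (respOp w u))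

lemma alphaMat_mulVec (U : HDiv) (j : E3) (v : Fin 3 → ℂ) :
    alphaMat U.linf U.linf j *ᵥ v = Complex.I •
      (cplx (‖j‖⁻¹ • j) ⨯₃ (⨍ x in cell, cplx (U.field x) ⨯₃
        (solOp U.linf U.linf (WithLp.toLp 2 v) x).ofLp)) := by
  rw [setAverage_eq_avgL, alphaMat, Matrix.smul_mulVec, ← Matrix.mulVec_mulVec, crossMat_mulVec,
    matOf_mulVec]
  rfl

/-- A solution map is unique when it exists, so it must be `solOp`, and a matrix is determined by
its action on vectors. -/
theorem isAlphaMatrix_iff (U : HDiv) (j : E3) (A : Matrix (Fin 3) (Fin 3) ℂ) :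
    IsAlphaMatrix U.field j A ↔
      IsUnit (1 - cellOp U.linf) ∧ A = alphaMat U.linf U.linf j := by
  constructor
  · rintro ⟨𝒮, h𝒮, hA⟩
    have hu := isUnit_of_isSolutionMap h𝒮
    have h2 := isSolutionMap_of_isUnit hu
    refine ⟨hu, ?_⟩
    have h3 : ∀ v, 𝒮 v = solOp U.linf U.linf (WithLp.toLp 2 v) := fun v =>
      (h2 v _).1 ((h𝒮 v _).2 rfl)
    refine Matrix.ext_of_mulVec_single fun b => ?_
    rw [hA, h3, alphaMat_mulVec]
  · rintro ⟨hu, rfl⟩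
    exact ⟨_, isSolutionMap_of_isUnit hu, alphaMat_mulVec U j⟩

/-- The only ingredient that is not linear or bilinear is the inverse, which is continuous at units
of a Banach algebra. -/
lemma continuousAt_alphaMat {w u : Lp C3 ⊤ (volume.restrict cell)}
    (h : IsUnit (1 - cellOp w)) (j : E3) :
    ContinuousAt (fun p : Lp C3 ⊤ (volume.restrict cell) × Lp C3 ⊤ (volume.restrict cell) =>
      alphaMat p.1 p.2 j) (w, u) := by
  have h1 : ContinuousAt (fun p : Lp C3 ⊤ (volume.restrict cell) ×
      Lp C3 ⊤ (volume.restrict cell) => Ring.inverse (1 - cellOp p.1)) (w, u) := by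
    obtain ⟨y, hy⟩ := h
    have hc := NormedRing.inverse_continuousAt y
    rw [hy] at hc
    exact ContinuousAt.comp (f := fun p : Lp C3 ⊤ (volume.restrict cell) ×
      Lp C3 ⊤ (volume.restrict cell) => 1 - cellOp p.1) (x := (w, u)) hc
      (continuous_const.sub (continuous_cellOp.comp continuous_fst)).continuousAt
  have h2 : Continuous fun p : Lp C3 ⊤ (volume.restrict cell) ×
      Lp C3 ⊤ (volume.restrict cell) => cellOp p.2 := continuous_cellOp.comp continuous_snd
  have h3 : ContinuousAt (fun p : Lp C3 ⊤ (volume.restrict cell) ×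
      Lp C3 ⊤ (volume.restrict cell) => respOp p.1 p.2) (w, u) := by
    unfold respOp solOp
    refine ContinuousAt.clm_comp (by fun_prop) (h1.clm_comp ?_)
    exact (h2.clm_comp continuous_const).continuousAt
  have h4 := continuous_matOf.continuousAt.comp h3
  unfold alphaMat
  exact (continuousAt_const.mul h4).const_smul Complex.I

/-- The reason for keeping `w` (inside the inverse) apart from `u`: with `w` frozen the response is
exactly quadratic in `u`. Hence `A(δU, j)` is `δ²` times a matrix that has a limit as `δ → 0`. -/
lemma respOp_smul_right (c : ℂ) (w u : Lp C3 ⊤ (volume.restrict cell)) :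
    respOp w (c • u) = c ^ 2 • respOp w u := by
  ext v : 1
  simp [respOp, solOp, cellOp, smul_smul, sq]

lemma alphaMat_smul_right (c : ℂ) (w u : Lp C3 ⊤ (volume.restrict cell)) (j : E3) :
    alphaMat w (c • u) j = c ^ 2 • alphaMat w u j := by
  have : matOf (c ^ 2 • respOp w u) = c ^ 2 • matOf (respOp w u) := by
    ext a b; simp [matOf]
  rw [alphaMat, respOp_smul_right, this, Matrix.mul_smul, smul_comm]
  rfl

/-! ### Simple unstable eigenvalues of `3 × 3` matrices -/

/-- The sum of the principal `2 × 2` minors. -/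
def minorSum {R : Type*} [CommRing R] (A : Matrix (Fin 3) (Fin 3) R) : R :=
  A 0 0 * A 1 1 - A 0 1 * A 1 0 + (A 0 0 * A 2 2 - A 0 2 * A 2 0)
    + (A 1 1 * A 2 2 - A 1 2 * A 2 1)

/-- The value of the characteristic polynomial. -/
noncomputable def charVal (A : Matrix (Fin 3) (Fin 3) ℂ) (p : ℂ) : ℂ :=
  p ^ 3 - A.trace * p ^ 2 + minorSum A * p - A.det

/-- The value of the derivative of the characteristic polynomial. -/
noncomputable def charDeriv (A : Matrix (Fin 3) (Fin 3) ℂ) (p : ℂ) : ℂ :=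
  3 * p ^ 2 - 2 * A.trace * p + minorSum A

lemma charpoly_fin_three (A : Matrix (Fin 3) (Fin 3) ℂ) :
    A.charpoly = Polynomial.X ^ 3 - Polynomial.C A.trace * Polynomial.X ^ 2
      + Polynomial.C (minorSum A) * Polynomial.X - Polynomial.C A.det := by
  refine Polynomial.funext fun p => ?_
  rw [Matrix.eval_charpoly, Matrix.det_fin_three]
  simp [Matrix.det_fin_three, Matrix.trace_fin_three, minorSum]
  ring

lemma eval_charpoly_eq (A : Matrix (Fin 3) (Fin 3) ℂ) (p : ℂ) :
    A.charpoly.eval p = charVal A p := by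
  rw [charpoly_fin_three]; simp [charVal]

lemma eval_derivative_charpoly_eq (A : Matrix (Fin 3) (Fin 3) ℂ) (p : ℂ) :
    A.charpoly.derivative.eval p = charDeriv A p := by
  rw [charpoly_fin_three]; simp [charDeriv]; ring

/-- Expresses simplicity through quantities that are jointly continuous in the matrix and the
eigenvalue. -/
lemma rootMultiplicity_eq_one_iff (A : Matrix (Fin 3) (Fin 3) ℂ) (p : ℂ) :
    A.charpoly.rootMultiplicity p = 1 ↔ charVal A p = 0 ∧ charDeriv A p ≠ 0 := by
  have h0 : A.charpoly ≠ 0 := A.charpoly_monic.ne_zero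
  have h1 := Polynomial.rootMultiplicity_pos h0 (x := p)
  have h2 := Polynomial.one_lt_rootMultiplicity_iff_isRoot h0 (t := p)
  rw [Polynomial.IsRoot, eval_charpoly_eq] at h1
  rw [Polynomial.IsRoot, Polynomial.IsRoot, eval_charpoly_eq, eval_derivative_charpoly_eq] at h2
  constructor
  · intro h
    refine ⟨h1.1 (by omega), fun h3 => ?_⟩
    have := h2.2 ⟨h1.1 (by omega), h3⟩
    omega
  · rintro ⟨h3, h4⟩
    have := h1.2 h3
    have h5 : ¬ 1 < A.charpoly.rootMultiplicity p := fun h => h4 (h2.1 h).2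
    omega

/-- The matrix has a simple eigenvalue with positive real part. -/
def SimpleUnstable (A : Matrix (Fin 3) (Fin 3) ℂ) : Prop :=
  ∃ p : ℂ, 0 < p.re ∧ A.charpoly.rootMultiplicity p = 1

/-- `‖q(p)‖` is the product of the distances from `p` to the roots; were they all at least `r`, it
would be at least `r` to the degree. This gives continuity of roots without contour integrals. -/
lemma exists_root_near {q : Polynomial ℂ} (hq : q.Monic) {p : ℂ} {r : ℝ} (hr : 0 < r)
    (h : ‖q.eval p‖ < r ^ q.natDegree) : ∃ z, q.eval z = 0 ∧ ‖p - z‖ < r := by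
  by_contra! hcon
  refine h.not_ge ?_
  have hs := IsAlgClosed.splits q
  rw [hs.eval_eq_prod_roots_of_monic hq, hs.natDegree_eq_card_roots]
  have hroots : ∀ z ∈ q.roots, r ≤ ‖p - z‖ := fun z hz =>
    hcon z (Polynomial.mem_roots'.1 hz).2
  generalize q.roots = s at hroots
  induction s using Multiset.induction_on with
  | empty => simp
  | cons a s ih =>
    rw [Multiset.map_cons, Multiset.prod_cons, norm_mul, Multiset.card_cons, pow_succ']
    exact mul_le_mul (hroots a (Multiset.mem_cons_self a s))
      (ih fun z hz => hroots z (Multiset.mem_cons_of_mem hz)) (by positivity) (norm_nonneg _)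

theorem isOpen_simpleUnstable : IsOpen {A | SimpleUnstable A} := by
  rw [isOpen_iff_mem_nhds]
  rintro A ⟨p, hp, hA⟩
  obtain ⟨h0, h1⟩ := (rootMultiplicity_eq_one_iff A p).1 hA
  have c1 : Continuous fun x : Matrix (Fin 3) (Fin 3) ℂ × ℂ => charDeriv x.1 x.2 := by
    simp only [charDeriv, minorSum, Matrix.trace_fin_three]
    fun_prop
  have c0 : Continuous fun B : Matrix (Fin 3) (Fin 3) ℂ => charVal B p := by
    simp only [charVal, minorSum, Matrix.trace_fin_three, Matrix.det_fin_three]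
    fun_prop
  have c2 : Continuous fun x : Matrix (Fin 3) (Fin 3) ℂ × ℂ => x.2.re :=
    Complex.continuous_re.comp continuous_snd
  -- Nonvanishing derivative and positive real part hold for every pair near `(A, p)`, so any root
  -- of a nearby matrix that is close enough to `p` inherits both.
  have e1 : ∀ᶠ x : Matrix (Fin 3) (Fin 3) ℂ × ℂ in nhds (A, p),
      charDeriv x.1 x.2 ≠ 0 ∧ 0 < x.2.re :=
    ((c1.tendsto (A, p)).eventually_ne h1).and ((c2.tendsto (A, p)).eventually_const_lt hp)
  rw [nhds_prod_eq] at e1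
  obtain ⟨pa, hpa, pb, hpb, hpp⟩ := Filter.eventually_prod_iff.1 e1
  obtain ⟨r, hr, hball⟩ := Metric.eventually_nhds_iff.1 hpb
  have e2 : ∀ᶠ B in nhds A, ‖charVal B p‖ < r ^ 3 := by
    refine c0.norm.continuousAt.eventually_lt_const ?_
    beta_reduce
    rw [h0, norm_zero]
    positivity
  filter_upwards [hpa, e2] with B hB1 hB2
  have hdeg : B.charpoly.natDegree = 3 := by rw [Matrix.charpoly_natDegree_eq_dim]; simp
  obtain ⟨z, hz, hzr⟩ := exists_root_near B.charpoly_monic (p := p) hr (by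
    rw [eval_charpoly_eq, hdeg]; exact hB2)
  have hz2 := hpp hB1 (hball (y := z) (by rw [dist_comm, dist_eq_norm]; exact hzr))
  rw [eval_charpoly_eq] at hz
  exact ⟨z, hz2.2, (rootMultiplicity_eq_one_iff B z).2 ⟨hz, hz2.1⟩⟩

lemma SimpleUnstable.smul {A : Matrix (Fin 3) (Fin 3) ℂ} (h : SimpleUnstable A) {r : ℝ}
    (hr : 0 < r) : SimpleUnstable ((r : ℂ) • A) := by
  obtain ⟨p, hp, hA⟩ := h
  obtain ⟨h0, h1⟩ := (rootMultiplicity_eq_one_iff A p).1 hA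
  refine ⟨r * p, by simp [hr, hp], (rootMultiplicity_eq_one_iff _ _).2 ⟨?_, ?_⟩⟩
  · have : charVal ((r : ℂ) • A) (r * p) = r ^ 3 * charVal A p := by
      simp only [charVal, minorSum, Matrix.trace_fin_three, Matrix.det_fin_three,
        Matrix.smul_apply, smul_eq_mul]
      ring
    rw [this, h0, mul_zero]
  · have : charDeriv ((r : ℂ) • A) (r * p) = r ^ 2 * charDeriv A p := by
      simp only [charDeriv, minorSum, Matrix.trace_fin_three, Matrix.smul_apply, smul_eq_mul]
      ring
    rw [this]
    have : (r : ℂ) ≠ 0 := by exact_mod_cast hr.ne'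
    positivity

/-- Otherwise `-adj M` is positive semidefinite with determinant `-(det M)² < 0`. The sign comes
from the odd dimension. -/
lemma exists_adjugate_pos {M : Matrix (Fin 3) (Fin 3) ℝ} (hM : M.IsSymm) (hdet : M.det ≠ 0) :
    ∃ a : Fin 3 → ℝ, 0 < a ⬝ᵥ (M.adjugate *ᵥ a) := by
  by_contra! h
  have hps : (-M.adjugate).PosSemidef := by
    refine Matrix.PosSemidef.of_dotProduct_mulVec_nonneg ?_ fun a => ?_
    · rw [Matrix.IsHermitian, Matrix.conjTranspose_eq_transpose_of_trivial, Matrix.transpose_neg,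
        Matrix.adjugate_transpose, hM]
    · rw [star_trivial, Matrix.neg_mulVec, dotProduct_neg]
      linarith [h a]
  have h1 := hps.det_nonneg
  rw [Matrix.det_neg, Matrix.det_adjugate] at h1
  have : 0 < M.det ^ 2 := by positivity
  simp only [Fintype.card_fin, Nat.add_one_sub_one] at h1
  linarith [h1]

/-- For a nonsingular real symmetric `M`, some `i ĵ × M` has a simple unstable eigenvalue. -/
theorem exists_simpleUnstable {M : Matrix (Fin 3) (Fin 3) ℝ} (hM : M.IsSymm) (hdet : M.det ≠ 0) :
    ∃ j : E3, j ≠ 0 ∧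
      SimpleUnstable (Complex.I • (crossMat (cplx (‖j‖⁻¹ • j)) * M.map Complex.ofReal)) := by
  obtain ⟨a, ha⟩ := exists_adjugate_pos hM hdet
  have ha0 : (WithLp.toLp 2 a : E3) ≠ 0 := by
    intro h
    have : a = 0 := by simpa using congrArg WithLp.ofLp h
    simp [this] at ha
  refine ⟨WithLp.toLp 2 a, ha0, ?_⟩
  set r : ℝ := ‖(WithLp.toLp 2 a : E3)‖⁻¹ with hr
  have hr0 : 0 < r := by rw [hr]; exact inv_pos.2 (norm_pos_iff.2 ha0)
  set μ : ℝ := r ^ 2 * (a ⬝ᵥ (M.adjugate *ᵥ a)) with hμ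
  have hμ0 : 0 < μ := by positivity
  have s10 : M 1 0 = M 0 1 := hM.apply 0 1
  have s20 : M 2 0 = M 0 2 := hM.apply 0 2
  have s21 : M 2 1 = M 1 2 := hM.apply 1 2
  set B := Complex.I • (crossMat (cplx (r • (WithLp.toLp 2 a : E3))) * M.map Complex.ofReal) with hB
  have hBe : ∀ i k, B i k = Complex.I * ∑ l,
      crossMat (cplx (r • (WithLp.toLp 2 a : E3))) i l * (M l k : ℂ) := by
    intro i k
    rw [hB, Matrix.smul_apply, Matrix.mul_apply]
    rfl
  -- The product of an antisymmetric and a symmetric matrix is traceless, and `a ×` is singular.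
  -- Only the minor sum survives, and `i² = -1` makes it `-μ`; the characteristic polynomial is `p³
  -- - μ p`, with derivative `2μ` at `√μ`.
  have htr : B.trace = 0 := by
    rw [Matrix.trace_fin_three, hBe, hBe, hBe]
    simp [crossMat, Fin.sum_univ_three, s10, s20, s21, cplx]
    ring
  have hd : B.det = 0 := by
    rw [hB, Matrix.det_smul, Matrix.det_mul]
    have : (crossMat (cplx (r • (WithLp.toLp 2 a : E3)))).det = 0 := by
      simp [crossMat, Matrix.det_fin_three]
      ring
    rw [this]; simp
  have hm : minorSum B = -(μ : ℂ) := by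
    rw [hμ, Matrix.adjugate_fin_three]
    simp only [minorSum, hBe]
    simp [crossMat, Fin.sum_univ_three, s10, s20, s21, cplx, dotProduct, Matrix.mulVec]
    ring_nf
    simp only [Complex.I_sq]
    ring
  have hsq : ((√μ : ℝ) : ℂ) ^ 2 = μ := by exact_mod_cast Real.sq_sqrt hμ0.le
  refine ⟨((√μ : ℝ) : ℂ), by simpa using hμ0, (rootMultiplicity_eq_one_iff _ _).2 ⟨?_, ?_⟩⟩
  · rw [charVal, htr, hd, hm, pow_succ, hsq]
    ring
  · rw [charDeriv, htr, hm, hsq]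
    have : (μ : ℂ) ≠ 0 := by exact_mod_cast hμ0.ne'
    intro h
    apply this
    linear_combination h / 2

/-! ### Sobolev embedding -/

/-- A continuous periodic field with absolutely summable Fourier coefficients is bounded by their
sum. -/
theorem norm_le_tsum_fc {f : E3 → C3} (hf : Continuous f) (hp : IsPeriodic f)
    (hs : Summable fun k => ‖fc f k‖) (x : E3) : ‖f x‖ ≤ cellVol⁻¹ * ∑' k, ‖fc f k‖ := by
  -- The Fourier series of `f`. It converges uniformly and has the coefficients of `f`, so it equals
  -- `f` almost everywhere, hence everywhere by continuity.
  let g : E3 → C3 := fun x => ∑' k, ((cellVol⁻¹ : ℝ) : ℂ) • chr k x • fc f k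
  have hV := cellVol_pos
  have hterm : ∀ k x, ‖((cellVol⁻¹ : ℝ) : ℂ) • chr k x • fc f k‖ = cellVol⁻¹ * ‖fc f k‖ := by
    intro k x
    rw [norm_smul, norm_smul, norm_chr, one_mul, Complex.norm_real, Real.norm_eq_abs,
      abs_of_pos (inv_pos.2 hV)]
  have hs' : Summable fun k => cellVol⁻¹ * ‖fc f k‖ := hs.mul_left _
  have hgc : Continuous g := continuous_tsum
    (fun k => by have := continuous_chr k; fun_prop) hs' (fun k x => (hterm k x).le)
  have hgp : IsPeriodic g := fun i x => by simp only [g, periodic_chr _ i x]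
  have hfcg : ∀ l, fc g l = fc f l := by
    intro l
    have h1 : HasSum (fun k => ∫ x in cell, chr (-l) x • ((cellVol⁻¹ : ℝ) : ℂ) • chr k x • fc f k)
        (∫ x in cell, ∑' k, chr (-l) x • ((cellVol⁻¹ : ℝ) : ℂ) • chr k x • fc f k) := by
      refine hasSum_integral_of_summable_integral_norm (fun k => ?_) ?_
      · exact integrable_chr_smul (integrable_cell
          (by have := continuous_chr k; fun_prop)) _
      · have : ∀ k, ∫ x in cell, ‖chr (-l) x • ((cellVol⁻¹ : ℝ) : ℂ) • chr k x • fc f k‖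
            = cellVol * (cellVol⁻¹ * ‖fc f k‖) := by
          intro k
          simp only [norm_smul (chr (-l) _), hterm, norm_chr, one_mul, integral_const,
            measureReal_restrict_apply_univ, smul_eq_mul]
          rfl
        simp only [this]
        exact hs'.mul_left _
    have h2 : ∀ k, ∫ x in cell, chr (-l) x • ((cellVol⁻¹ : ℝ) : ℂ) • chr k x • fc f k
        = if k = l then fc f l else 0 := by
      intro k
      have e : (fun x => chr (-l) x • ((cellVol⁻¹ : ℝ) : ℂ) • chr k x • fc f k)
          = fun x => chr (k - l) x • (((cellVol⁻¹ : ℝ) : ℂ) • fc f k) := by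
        funext x
        rw [sub_eq_neg_add, ← chr_mul, mul_smul, smul_comm (chr k x)]
      rw [e, integral_smul_const]
      split_ifs with h
      · subst h
        simp only [sub_self, chr_zero, integral_const, measureReal_restrict_apply_univ]
        rw [smul_smul]
        have hV' : ((cellVol : ℝ) : ℂ) ≠ 0 := by exact_mod_cast hV.ne'
        have : (volume : Measure E3).real cell = cellVol := rfl
        rw [this]
        simp [hV']
      · rw [integral_chr (fun h' => h (sub_eq_zero.1 h')), zero_smul]
    simp only [h2] at h1
    have h3 := h1.unique (hasSum_ite_eq l (fc f l))
    rw [← h3, fc]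
    refine integral_congr_ae (Filter.Eventually.of_forall fun x => ?_)
    simp only [g]
    rw [← Summable.tsum_const_smul]
    exact Summable.of_norm (by simpa only [hterm] using hs')
  have hfg : (memLp_cell hf 2).toLp f = (memLp_cell hgc 2).toLp g := by
    refine L2Torus.ext_fc fun k => ?_
    rw [fc_congr_ae (memLp_cell hf 2).coeFn_toLp, fc_congr_ae (memLp_cell hgc 2).coeFn_toLp, hfcg]
  have hae : (fun x => f x - g x) =ᵐ[volume.restrict cell] 0 := by
    have h1 := (memLp_cell hf 2).coeFn_toLp
    have h2 := (memLp_cell hgc 2).coeFn_toLp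
    rw [hfg] at h1
    filter_upwards [h1, h2] with x h1 h2
    rw [← h1, ← h2]
    simp
  have h0 := congrFun (eq_zero_of_ae_cell (hf.sub hgc)
    (fun i x => by change f _ - g _ = f _ - g _; rw [hp, hgp]) hae) x
  have hx : f x = g x := sub_eq_zero.1 h0
  rw [hx, ← tsum_mul_left]
  exact tsum_of_norm_bounded hs'.hasSum fun k => (hterm k x).le

lemma fc_pd_iterate {f : E3 → C3} (hf : ContDiff ℝ ∞ f) (hp : IsPeriodic f) (i : Fin 3) (n : ℕ)
    (k : Fin 3 → ℤ) : (ContDiff ℝ ∞ ((pd i)^[n] f) ∧ IsPeriodic ((pd i)^[n] f)) ∧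
      fc ((pd i)^[n] f) k = (Complex.I * k i) ^ n • fc f k := by
  induction n with
  | zero => exact ⟨⟨hf, hp⟩, by simp⟩
  | succ n ih =>
    rw [Function.iterate_succ_apply']
    refine ⟨⟨ContDiff.pd_infty ih.1.1 i, ih.1.2.pd i⟩, ?_⟩
    rw [fc_pd (ih.1.1.of_le (by simp)) ih.1.2, ih.2, smul_smul, pow_succ']

/-- The inclusion of real vectors in `C3`, as a real-linear map. -/
noncomputable def cplxCLM : E3 →L[ℝ] C3 :=
  LinearMap.toContinuousLinearMap
    { toFun := cplxC3
      map_add' := fun a b => by ext i; simp [cplxC3, cplx]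
      map_smul' := fun c a => by ext i; simp [cplxC3, cplx] }

lemma cplxCLM_apply (u : E3) : cplxCLM u = cplxC3 u := rfl

lemma pd_cplx {f : E3 → E3} (hf : ContDiff ℝ ∞ f) (i : Fin 3) :
    pd i (fun x => cplxC3 (f x)) = fun x => cplxC3 (pd i f x) := by
  funext x
  have h := cplxCLM.hasFDerivAt.comp x (hf.differentiable (by simp) x).hasFDerivAt
  rw [pd, show (fun x => cplxC3 (f x)) = cplxCLM ∘ f from rfl, h.fderiv]
  rfl

lemma pd_iterate_cplx {f : E3 → E3} (hf : ContDiff ℝ ∞ f) (i : Fin 3) (n : ℕ) :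
    (pd i)^[n] (fun x => cplxC3 (f x)) = fun x => cplxC3 ((pd i)^[n] f x) := by
  induction n with
  | zero => rfl
  | succ n ih =>
    rw [Function.iterate_succ_apply', Function.iterate_succ_apply', ih,
      pd_cplx (contDiff_pd_iterate hf i n)]

lemma HDiv.contDiff_cplx (U : HDiv) : ContDiff ℝ ∞ fun x => cplxC3 (U.field x) :=
  cplxCLM.contDiff.comp U.contDiff

lemma HDiv.periodic_cplx (U : HDiv) : IsPeriodic fun x => cplxC3 (U.field x) :=
  fun i x => by simp only [U.periodic i x]

lemma HDiv.fc_cplx_zero (U : HDiv) : fc (fun x => cplxC3 (U.field x)) 0 = 0 := by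
  rw [fc_zero_eq]
  have h := cplxCLM.integral_comp_comm (integrable_cell U.contDiff.continuous)
  have h0 : ∫ x in cell, U.field x = 0 := U.2.2.2.1
  rw [h0, map_zero] at h
  exact h

lemma integral_norm_le_l2Norm {f : E3 → E3} (hf : Continuous f) :
    ∫ x in cell, ‖f x‖ ≤ √cellVol * l2Norm f := by
  have h := eLpNorm_le_eLpNorm_mul_rpow_measure_univ (μ := volume.restrict cell)
    (p := 1) (q := 2) (f := f) (by norm_num) hf.aestronglyMeasurable
  have h2 := memLp_of_continuous hf 2
  have h1 : ∫ x in cell, ‖f x‖ = (eLpNorm f 1 (volume.restrict cell)).toReal := by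
    rw [eLpNorm_one_eq_lintegral_enorm, integral_norm_eq_lintegral_enorm hf.aestronglyMeasurable]
  rw [h1, mul_comm, l2Norm]
  have e : √cellVol = (((volume.restrict cell) (Set.univ : Set E3)) ^
      (1 / (1 : ℝ≥0∞).toReal - 1 / (2 : ℝ≥0∞).toReal)).toReal := by
    rw [← ENNReal.toReal_rpow, Measure.restrict_apply_univ, Real.sqrt_eq_rpow]
    norm_num
    rfl
  rw [e, ← ENNReal.toReal_mul]
  refine ENNReal.toReal_mono (ENNReal.mul_ne_top h2.eLpNorm_ne_top ?_) h
  refine ENNReal.rpow_ne_top_of_nonneg (by norm_num) (measure_ne_top _ _)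

lemma l2Norm_le_sobolevNorm {n : ℕ} {α : Fin 3 → ℕ} (hα : α ∈ multiIndices n) (U : HDiv) :
    l2Norm (pdMulti α U.field) ≤ sobolevNorm n U := by
  refine Real.le_sqrt_of_sq_le ?_
  exact Finset.single_le_sum (f := fun α => l2Norm (pdMulti α U.field) ^ 2)
    (fun _ _ => sq_nonneg _) hα

lemma l2Norm_pd_iterate_le (n : ℕ) (i : Fin 3) (U : HDiv) :
    l2Norm ((pd i)^[n] U.field) ≤ sobolevNorm n U := by
  have h : pdMulti (Pi.single i n) U.field = (pd i)^[n] U.field := by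
    fin_cases i <;> simp [pdMulti]
  rw [← h]
  refine l2Norm_le_sobolevNorm ?_ U
  rw [multiIndices, Finset.mem_filter, Fintype.mem_piFinset]
  refine ⟨fun j => ?_, ?_⟩
  · by_cases hj : j = i
    · subst hj; simp
    · simp [hj]
  · simp [Finset.sum_pi_single']

/-- The exponent `4` exceeds the rank `3` of the lattice. -/
lemma summable_norm_inv_pow_four : Summable fun k : Fin 3 → ℤ => ‖k‖⁻¹ ^ 4 := by
  let L : Submodule ℤ (Fin 3 → ℝ) := Submodule.span ℤ (Set.range (Pi.basisFun ℝ (Fin 3)))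
  have hr : Module.finrank ℤ L = 3 := by
    rw [ZLattice.rank ℝ L]; simp
  have h := ZLattice.summable_norm_pow_inv L 4 (by rw [hr]; norm_num)
  let e : (Fin 3 → ℤ) → L := fun k => ⟨fun i => (k i : ℝ), by
    rw [Module.Basis.mem_span_iff_repr_mem]
    intro i
    exact ⟨k i, by simp⟩⟩
  have he : Function.Injective e := by
    intro k l hkl
    funext i
    have := congrFun (congrArg Subtype.val hkl) i
    simpa [e] using this
  refine (h.comp_injective he).congr fun k => ?_
  have hn : ‖e k‖ = ‖k‖ := by
    refine le_antisymm ((pi_norm_le_iff_of_nonneg (norm_nonneg k)).2 fun i => ?_)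
      ((pi_norm_le_iff_of_nonneg (norm_nonneg _)).2 fun i => ?_)
    · have := norm_le_pi_norm k i
      simpa [e, Int.norm_eq_abs] using this
    · have := norm_le_pi_norm (e k : Fin 3 → ℝ) i
      simpa [e, Int.norm_eq_abs] using this
  simp only [Function.comp_apply, hn]

/-- Differentiate five times along the coordinate where the sup norm of `k` is attained. -/
lemma norm_fc_mul_le (U : HDiv) (k : Fin 3 → ℤ) :
    ‖fc (fun x => cplxC3 (U.field x)) k‖ * ‖k‖ ^ 5 ≤ √cellVol * sobolevNorm 5 U := by
  obtain ⟨i, hi⟩ : ∃ i, ‖k‖ = ‖k i‖ := by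
    by_contra! h
    have h' : ∀ i, ‖k i‖ < ‖k‖ := fun i => lt_of_le_of_ne (norm_le_pi_norm k i) (h i).symm
    have h0 : 0 < ‖k‖ := (norm_nonneg _).trans_lt (h' 0)
    exact lt_irrefl _ ((pi_norm_lt_iff h0).2 h')
  have h := (fc_pd_iterate U.contDiff_cplx U.periodic_cplx i 5 k).2
  have h2 := norm_fc_le ((pd i)^[5] fun x => cplxC3 (U.field x)) k
  rw [h, norm_smul, norm_pow, norm_mul, Complex.norm_I, one_mul, Complex.norm_intCast,
    pd_iterate_cplx U.contDiff] at h2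
  simp only [norm_cplxC3] at h2
  rw [hi, Int.norm_eq_abs, mul_comm]
  refine h2.trans ((integral_norm_le_l2Norm (contDiff_pd_iterate U.contDiff i 5).continuous).trans ?_)
  gcongr
  exact l2Norm_pd_iterate_le 5 i U

/-- The Sobolev embedding of `H⁵` in `C¹`. -/
theorem exists_sobolev_bound : ∃ C : ℝ, 0 ≤ C ∧ ∀ (U : HDiv) (x : E3),
    ‖U.field x‖ ≤ C * sobolevNorm 5 U ∧ ∀ a, ‖pd a U.field x‖ ≤ C * sobolevNorm 5 U := by
  refine ⟨cellVol⁻¹ * (√cellVol * ∑' k : Fin 3 → ℤ, ‖k‖⁻¹ ^ 4), ?_, fun U x => ?_⟩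
  · have := cellVol_pos
    have : 0 ≤ ∑' k : Fin 3 → ℤ, ‖k‖⁻¹ ^ 4 := tsum_nonneg fun _ => by positivity
    positivity
  have hone : ∀ k : Fin 3 → ℤ, k ≠ 0 → 1 ≤ ‖k‖ := by
    intro k hk
    obtain ⟨i, hi⟩ : ∃ i, k i ≠ 0 := by
      by_contra h; push Not at h; exact hk (funext h)
    refine le_trans ?_ (norm_le_pi_norm k i)
    rw [Int.norm_eq_abs]
    exact_mod_cast Int.one_le_abs hi
  -- Of the five powers of decay, one pays for a derivative and four for summability over `ℤ³`.
  have key : ∀ f : E3 → C3, Continuous f → IsPeriodic f →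
      (∀ k, ‖fc f k‖ ≤ ‖k‖ * ‖fc (fun x => cplxC3 (U.field x)) k‖) →
      ‖f x‖ ≤ cellVol⁻¹ * (√cellVol * ∑' k : Fin 3 → ℤ, ‖k‖⁻¹ ^ 4) * sobolevNorm 5 U := by
    intro f hf hp hfc
    have hb : ∀ k, ‖fc f k‖ ≤ (√cellVol * sobolevNorm 5 U) * ‖k‖⁻¹ ^ 4 := by
      intro k
      refine (hfc k).trans ?_
      by_cases hk : k = 0
      · simp [hk]
      have h1 := hone k hk
      have h2 := norm_fc_mul_le U k
      rw [inv_pow, ← div_eq_mul_inv, le_div_iff₀ (by positivity)]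
      calc ‖k‖ * ‖fc (fun x => cplxC3 (U.field x)) k‖ * ‖k‖ ^ 4
          = ‖fc (fun x => cplxC3 (U.field x)) k‖ * ‖k‖ ^ 5 := by ring
        _ ≤ _ := h2
    have hs := summable_norm_inv_pow_four.mul_left (√cellVol * sobolevNorm 5 U)
    have hsf : Summable fun k => ‖fc f k‖ := hs.of_nonneg_of_le (fun _ => norm_nonneg _) hb
    have h3 := hsf.tsum_le_tsum hb hs
    rw [tsum_mul_left] at h3
    have hV := cellVol_pos
    calc ‖f x‖ ≤ cellVol⁻¹ * ∑' k, ‖fc f k‖ := norm_le_tsum_fc hf hp hsf x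
      _ ≤ cellVol⁻¹ * (√cellVol * sobolevNorm 5 U * ∑' k : Fin 3 → ℤ, ‖k‖⁻¹ ^ 4) := by gcongr
      _ = _ := by ring
  constructor
  · rw [← norm_cplxC3]
    refine key (fun x => cplxC3 (U.field x)) U.contDiff_cplx.continuous U.periodic_cplx fun k => ?_
    -- The comparison with `‖k‖` is possible at `k = 0` because the field is mean-free.
    by_cases hk : k = 0
    · rw [hk, U.fc_cplx_zero]; simp
    exact le_mul_of_one_le_left (norm_nonneg _) (hone k hk)
  · intro a
    rw [← norm_cplxC3]
    have h1 : ContDiff ℝ 1 fun x => cplxC3 (U.field x) := U.contDiff_cplx.of_le (by simp)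
    have h2 := pd_cplx U.contDiff a
    refine key (fun x => cplxC3 (pd a U.field x)) (h2 ▸ continuous_pd h1 a)
      (h2 ▸ U.periodic_cplx.pd a) fun k => ?_
    · rw [← h2, fc_pd h1 U.periodic_cplx, norm_smul, norm_mul, Complex.norm_I,
        one_mul, Complex.norm_intCast]
      gcongr
      have := norm_le_pi_norm k a
      rwa [Int.norm_eq_abs] at this

lemma norm_le_sum_pd (f' : E3 →L[ℝ] E3) :
    ‖f'‖ ≤ ∑ a, ‖f' (EuclideanSpace.single a 1)‖ := by
  refine f'.opNorm_le_bound (Finset.sum_nonneg fun _ _ => norm_nonneg _) fun v => ?_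
  have hv : v = ∑ a, v a • EuclideanSpace.single a (1 : ℝ) := by
    ext i; simp [Pi.single_apply]
  conv_lhs => rw [hv, map_sum]
  rw [Finset.sum_mul]
  refine (norm_sum_le _ _).trans (Finset.sum_le_sum fun a _ => ?_)
  rw [map_smul, norm_smul, mul_comm]
  gcongr
  exact PiLp.norm_apply_le v a

/-! ### The topology of `HDiv` -/

lemma tendsto_sobolevNorm_sub (n : ℕ) (U : HDiv) :
    Filter.Tendsto (fun V : HDiv => sobolevNorm n (V - U)) (nhds U) (nhds 0) := by
  rw [Metric.tendsto_nhds]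
  intro ε hε
  -- The distance dominates its `n`-th term, and `s ↦ s / (1 + s)` is increasing, so this radius
  -- forces the `H^n` norm below `ε`.
  have hδ : 0 < (1 / 2 : ℝ) ^ n * (ε / (1 + ε)) := by positivity
  filter_upwards [Metric.ball_mem_nhds U hδ] with V hV
  have hd : dHInf V U < (1 / 2 : ℝ) ^ n * (ε / (1 + ε)) := hV
  have hle := (summable_dHInf V U).le_tsum n (fun m _ => by
    have := sobolevNorm_nonneg m (V - U); positivity)
  have hs := sobolevNorm_nonneg n (V - U)
  have h1 := lt_of_mul_lt_mul_left (lt_of_le_of_lt hle hd) (by positivity)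
  rw [div_lt_div_iff₀ (by positivity) (by positivity)] at h1
  rw [Real.dist_eq, sub_zero, abs_of_nonneg hs]
  linarith

lemma sobolevNorm_smul (n : ℕ) (c : ℝ) (U : HDiv) :
    sobolevNorm n (c • U) = |c| * sobolevNorm n U := by
  have h : ∀ α, l2Norm (pdMulti α (c • U).field) = |c| * l2Norm (pdMulti α U.field) := by
    intro α
    rw [HDiv.field_smul, pdMulti_smul U.contDiff, l2Norm, l2Norm, eLpNorm_const_smul]
    simp
  simp only [sobolevNorm, h, mul_pow, ← Finset.mul_sum]
  rw [Real.sqrt_mul (by positivity), Real.sqrt_sq (abs_nonneg c)]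

/-- Each term of the series tends to zero and is at most `2⁻ⁿ`, so dominated convergence applies. -/
lemma tendsto_add_smul (U W : HDiv) :
    Filter.Tendsto (fun t : ℝ => U + t • W) (nhds 0) (nhds U) := by
  rw [tendsto_iff_dist_tendsto_zero]
  have h : ∀ t : ℝ, dist (U + t • W) U = ∑' n : ℕ, (1 / 2 : ℝ) ^ n *
      (|t| * sobolevNorm n W / (1 + |t| * sobolevNorm n W)) := by
    intro t
    change dHInf _ _ = _
    simp only [dHInf, add_sub_cancel_left, sobolevNorm_smul]
  simp only [h]
  have h0 : (∑' n : ℕ, (1 / 2 : ℝ) ^ n * 0) = 0 := by simp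
  rw [← h0]
  refine tendsto_tsum_of_dominated_convergence summable_geometric_two (fun n => ?_)
    (Filter.Eventually.of_forall fun t n => ?_)
  · have hs := sobolevNorm_nonneg n W
    have hc : Continuous fun t : ℝ => (1 / 2 : ℝ) ^ n *
      (|t| * sobolevNorm n W / (1 + |t| * sobolevNorm n W)) := by
      refine continuous_const.mul (Continuous.div (by fun_prop) (by fun_prop) fun t => ?_)
      positivity
    simpa using hc.tendsto 0
  · have hs := sobolevNorm_nonneg n W
    rw [Real.norm_of_nonneg (by positivity)]
    refine mul_le_of_le_one_right (by positivity) ?_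
    rw [div_le_one (by positivity)]
    linarith

lemma continuous_linf : Continuous HDiv.linf := by
  rw [continuous_iff_continuousAt]
  intro U
  obtain ⟨C, hC, hb⟩ := exists_sobolev_bound
  rw [ContinuousAt, tendsto_iff_norm_sub_tendsto_zero]
  have h := (tendsto_sobolevNorm_sub 5 U).const_mul C
  rw [mul_zero] at h
  refine squeeze_zero (fun _ => norm_nonneg _) (fun V => ?_) h
  rw [← HDiv.linf_sub]
  exact HDiv.norm_linf_le _ (mul_nonneg hC (sobolevNorm_nonneg _ _)) fun x => (hb (V - U) x).1

/-- The supremum of the operator norm of the gradient. -/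
lemma exists_gradient_bound : ∃ C : ℝ, 0 ≤ C ∧ ∀ (U : HDiv) (x : E3),
    ‖fderiv ℝ U.field x‖ ≤ C * sobolevNorm 5 U := by
  obtain ⟨C, hC, hb⟩ := exists_sobolev_bound
  refine ⟨3 * C, by positivity, fun U x => (norm_le_sum_pd _).trans ?_⟩
  calc ∑ a, ‖fderiv ℝ U.field x (EuclideanSpace.single a 1)‖
      ≤ ∑ _a : Fin 3, C * sobolevNorm 5 U := Finset.sum_le_sum fun a _ => (hb U x).2 a
    _ = 3 * C * sobolevNorm 5 U := by simp; ring

lemma HDiv.fderiv_sub (U V : HDiv) (x : E3) :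
    fderiv ℝ (U - V).field x = fderiv ℝ U.field x - fderiv ℝ V.field x := by
  rw [HDiv.field_sub, _root_.fderiv_sub (U.contDiff.differentiable (by simp) x)
    (V.contDiff.differentiable (by simp) x)]

/-- The condition on the gradient is open. -/
lemma isOpen_gradient_lt : IsOpen {U : HDiv | (⨆ x, ‖fderiv ℝ U.field x‖ₑ) < 1} := by
  rw [isOpen_iff_mem_nhds]
  intro U hU
  obtain ⟨r, hr1, hr2⟩ := exists_between (show (⨆ x, ‖fderiv ℝ U.field x‖ₑ) < 1 from hU)
  have hrt : r ≠ ⊤ := (hr2.trans ENNReal.one_lt_top).ne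
  have hr3 : r.toReal < 1 := by
    rw [← ENNReal.toReal_one]
    exact (ENNReal.toReal_lt_toReal hrt ENNReal.one_ne_top).2 hr2
  obtain ⟨C, hC, hb⟩ := exists_gradient_bound
  have h := (tendsto_sobolevNorm_sub 5 U).const_mul C
  rw [mul_zero] at h
  -- A perturbation of half the gap keeps the gradient uniformly below `(1 + r) / 2`, so the
  -- supremum stays strictly below `1`.
  filter_upwards [h.eventually_lt_const (show 0 < (1 - r.toReal) / 2 by linarith)] with V hV
  have hx : ∀ x, ‖fderiv ℝ V.field x‖ ≤ (1 + r.toReal) / 2 := by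
    intro x
    have h1 : ‖fderiv ℝ U.field x‖ ≤ r.toReal := by
      have h2 : ‖fderiv ℝ U.field x‖ₑ ≤ r := (le_iSup _ x).trans hr1.le
      have h3 := ENNReal.toReal_mono hrt h2
      simpa using h3
    have h4 := hb (V - U) x
    rw [HDiv.fderiv_sub] at h4
    have h5 := norm_le_norm_add_norm_sub' (fderiv ℝ V.field x) (fderiv ℝ U.field x)
    linarith
  refine lt_of_le_of_lt (iSup_le fun x => ?_) (b := ENNReal.ofReal ((1 + r.toReal) / 2)) ?_
  · rw [← ofReal_norm]
    exact ENNReal.ofReal_le_ofReal (hx x)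
  · rw [← ENNReal.ofReal_one]
    exact (ENNReal.ofReal_lt_ofReal_iff one_pos).2 (by linarith)

lemma continuous_const_smul_HDiv (c : ℝ) : Continuous fun U : HDiv => c • U := by
  rw [continuous_iff_continuousAt]
  intro U
  rw [ContinuousAt, tendsto_iff_dist_tendsto_zero]
  have h : ∀ V : HDiv, dist (c • V) (c • U) = ∑' n : ℕ, (1 / 2 : ℝ) ^ n *
      (|c| * sobolevNorm n (V - U) / (1 + |c| * sobolevNorm n (V - U))) := by
    intro V
    change dHInf _ _ = _
    simp only [dHInf, ← smul_sub, sobolevNorm_smul]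
  simp only [h]
  have h0 : (∑' n : ℕ, (1 / 2 : ℝ) ^ n * 0) = 0 := by simp
  rw [← h0]
  refine tendsto_tsum_of_dominated_convergence summable_geometric_two (fun n => ?_)
    (Filter.Eventually.of_forall fun V n => ?_)
  · have h1 := (tendsto_sobolevNorm_sub n U).const_mul |c|
    rw [mul_zero] at h1
    have h2 := (h1.div (h1.const_add 1) (by norm_num)).const_mul ((1 / 2 : ℝ) ^ n)
    simpa using h2
  · have hs := sobolevNorm_nonneg n (V - U)
    rw [Real.norm_of_nonneg (by positivity)]
    refine mul_le_of_le_one_right (by positivity) ?_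
    rw [div_le_one (by positivity)]
    linarith

/-! ### The second-order response -/

/-- The part of the response which is of second order in the field, as a bilinear expression. -/
noncomputable def quadResp (u w : Lp C3 ⊤ (volume.restrict cell)) : C3 →L[ℂ] C3 :=
  (avgL.comp (mult u)).comp ((cellOp w).comp constField)

/-- At `w = 0` the inverse is the identity; this is the limit of the rescaled response as the
amplitude tends to zero. -/
lemma respOp_zero (u : Lp C3 ⊤ (volume.restrict cell)) : respOp 0 u = quadResp u u := by
  simp [respOp, solOp, quadResp, cellOp]
  rfl

lemma matOf_quadResp_add_smul (u w : Lp C3 ⊤ (volume.restrict cell)) (t : ℂ) :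
    matOf (quadResp (u + t • w) (u + t • w)) = matOf (quadResp u u)
      + t • (matOf (quadResp u w) + matOf (quadResp w u)) + t ^ 2 • matOf (quadResp w w) := by
  ext a b
  simp [matOf, quadResp, cellOp]
  ring

lemma mult_constField_coe (U : HDiv) (v : C3) : mult U.linf (constField v)
    =ᵐ[volume.restrict cell] fun x => crossL (cplxC3 (U.field x)) v := by
  filter_upwards [mult_coe U.linf (constField v), U.linf_coe, constField_coe v] with x h1 h2 h3
  rw [h1, h2, h3]

/-- Pointwise `e_a · (U × Y) = -(U × e_a) · Y`. The entries thus become values of the form of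
`(-Δ)⁻¹ curl` on the real fields `U × e_a`. -/
lemma matOf_quadResp_apply (U : HDiv) (a b : Fin 3) :
    matOf (quadResp U.linf U.linf) a b = -((cellVol⁻¹ : ℝ) : ℂ) *
      inner ℂ (mult U.linf (constField (EuclideanSpace.single a 1)))
        (curlInv (mult U.linf (constField (EuclideanSpace.single b 1)))) := by
  set Y := curlInv (mult U.linf (constField (EuclideanSpace.single b 1))) with hY
  have h1 : matOf (quadResp U.linf U.linf) a b = avgL (mult U.linf Y) a := rfl
  have h2 : (∫ x in cell, mult U.linf Y x) a = ∫ x in cell, mult U.linf Y x a :=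
    ((EuclideanSpace.proj a : C3 →L[ℂ] ℂ).integral_comp_comm
      (integrable_L2 (mult U.linf Y))).symm
  rw [h1, avgL_apply, PiLp.smul_apply, smul_eq_mul, neg_mul, ← mul_neg, h2, L2.inner_def,
    ← integral_neg]
  congr 1
  refine integral_congr_ae ?_
  filter_upwards [mult_coe U.linf Y, U.linf_coe,
    mult_constField_coe U (EuclideanSpace.single a 1)] with x h1 h2 h3
  rw [h1, h2, h3]
  have hconj : ∀ i, (starRingEnd ℂ) (cplx (U.field x) i) = cplx (U.field x) i := by simp [cplx]
  simp only [crossL_apply, PiLp.inner_apply, Fin.sum_univ_three, cplxC3]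
  fin_cases a <;> simp [cross_apply, hconj] <;> ring

lemma isRealField_mult_constField (U : HDiv) (a : Fin 3) :
    IsRealField (mult U.linf (constField (EuclideanSpace.single a 1))) := by
  intro k m
  have hc : Continuous fun x => crossL (cplxC3 (U.field x)) (EuclideanSpace.single a 1) :=
    (crossL.flip (EuclideanSpace.single a 1)).continuous.comp U.contDiff_cplx.continuous
  rw [fc_congr_ae (mult_constField_coe U _), fc_congr_ae (mult_constField_coe U _),
    fc_comp_C3 (integrable_cell hc), fc_comp_C3 (integrable_cell hc)]
  have h := fc_conj (fun x => crossL (cplxC3 (U.field x)) (EuclideanSpace.single a 1) m) (-k)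
  rw [neg_neg] at h
  rw [← h]
  congr 1
  funext x
  fin_cases a <;> fin_cases m <;> simp [crossL_apply, cross_apply, cplxC3, cplx]

/-- The second-order response of a real field is a real symmetric matrix. -/
theorem exists_real_symm (U : HDiv) : ∃ M : Matrix (Fin 3) (Fin 3) ℝ, M.IsSymm ∧
    matOf (quadResp U.linf U.linf) = M.map Complex.ofReal := by
  set A := matOf (quadResp U.linf U.linf) with hA
  have hreal : ∀ a b, (starRingEnd ℂ) (A a b) = A a b := by
    intro a b
    rw [hA, matOf_quadResp_apply, map_mul, map_neg, Complex.conj_ofReal,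
      (isRealField_mult_constField U a).conj_inner (isRealField_mult_constField U b).curlInv]
  -- Self-adjointness gives a Hermitian matrix; reality of its entries makes it symmetric.
  have hsymm : ∀ a b, A b a = A a b := by
    intro a b
    rw [← hreal a b, hA, matOf_quadResp_apply, matOf_quadResp_apply, map_mul, map_neg,
      Complex.conj_ofReal, inner_conj_symm, inner_curlInv_left]
  refine ⟨A.map Complex.re, ?_, ?_⟩
  · ext a b
    simp [hsymm]
  · ext a b
    exact (Complex.conj_eq_iff_re.1 (hreal a b)).symm

/-! ### A field with nonsingular second-order response -/

section Trig

variable {V : Type*} [NormedAddCommGroup V] [NormedSpace ℝ V]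

/-- A sum of plane waves along the coordinate axes. -/
noncomputable def trig (p q : Fin 3 → V) (x : E3) : V :=
  ∑ j, (Real.sin (x j) • p j + Real.cos (x j) • q j)

lemma contDiff_trig (p q : Fin 3 → V) : ContDiff ℝ ∞ (trig p q) := by
  unfold trig
  refine ContDiff.sum fun j _ => ?_
  have h : ContDiff ℝ ∞ fun x : E3 => x j := (EuclideanSpace.proj j : E3 →L[ℝ] ℝ).contDiff
  exact (h.sin.smul contDiff_const).add (h.cos.smul contDiff_const)

lemma periodic_trig (p q : Fin 3 → V) : IsPeriodic (trig p q) := by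
  intro i x
  refine Finset.sum_congr rfl fun j _ => ?_
  by_cases hj : j = i
  · subst hj; simp
  · simp [hj]

/-- The family is closed under differentiation, and a derivative along axis `i` retains only the
modes depending on `x i`. -/
lemma pd_trig (p q : Fin 3 → V) (i : Fin 3) :
    pd i (trig p q) = trig (Pi.single i (-q i)) (Pi.single i (p i)) := by
  funext x
  have h : HasFDerivAt (trig p q) (∑ j,
      ((Real.cos (x j) • (EuclideanSpace.proj j : E3 →L[ℝ] ℝ)).smulRight (p j)
        + (-Real.sin (x j) • (EuclideanSpace.proj j : E3 →L[ℝ] ℝ)).smulRight (q j))) x := by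
    refine HasFDerivAt.fun_sum fun j _ => ?_
    have hp : HasFDerivAt (fun x : E3 => x j) (EuclideanSpace.proj j : E3 →L[ℝ] ℝ) x :=
      (EuclideanSpace.proj j : E3 →L[ℝ] ℝ).hasFDerivAt
    exact (hp.sin.smul_const (p j)).add (hp.cos.smul_const (q j))
  rw [pd, h.fderiv, trig, _root_.sum_apply]
  refine Finset.sum_congr rfl fun j _ => ?_
  by_cases hj : j = i
  · subst hj; simp; abel
  · simp [hj]

end Trig

/-- The field `(sin x₂ + cos x₁, sin x₀ + cos x₂, sin x₁ + cos x₀)`. -/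
noncomputable def abcField : E3 → E3 :=
  trig (fun j => EuclideanSpace.single (j + 1) 1) (fun j => EuclideanSpace.single (j + 2) 1)

/-- All modes have `|k| = 1`, so `-Δ` acts as the identity. -/
lemma abcField_eq : abcField = fun x => -∑ i, pd i (pd i abcField) x := by
  funext x
  simp only [abcField, pd_trig]
  simp [trig, Fin.sum_univ_three]
  abel

/-- The Arnold–Beltrami–Childress field, as an element of `HDiv`. -/
noncomputable def abc : HDiv := ⟨abcField, contDiff_trig _ _, periodic_trig _ _, by
  have hc := contDiff_trig (fun j : Fin 3 => (EuclideanSpace.single (j + 1) 1 : E3))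
    (fun j => EuclideanSpace.single (j + 2) 1)
  have hp := periodic_trig (fun j : Fin 3 => (EuclideanSpace.single (j + 1) 1 : E3))
    (fun j => EuclideanSpace.single (j + 2) 1)
  rw [abcField_eq, integral_neg, integral_finsetSum]
  · rw [Finset.sum_eq_zero fun i _ => ?_, neg_zero]
    exact integral_pd_eq_zero ((contDiff_pd hc i).of_le (by simp)) (hp.pd i) i
  · exact fun i _ => integrable_cell (contDiff_pd (contDiff_pd hc i) i).continuous, fun x => by
  -- The modes varying along axis `j` point along axes `j + 1` and `j + 2` modulo `3`, never along
  -- `j`.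
  simp only [divergence, abcField, pd_trig]
  simp [trig, Fin.sum_univ_three]⟩

lemma pd_crossL {f g : E3 → C3} (hf : ContDiff ℝ 1 f) (hg : ContDiff ℝ 1 g) (i : Fin 3) (x : E3) :
    pd i (fun x => crossL (f x) (g x)) x = crossL (pd i f x) (g x) + crossL (f x) (pd i g x) := by
  have h := (crossL.bilinearRestrictScalars ℝ).hasFDerivAt_of_bilinear
    (hf.differentiable one_ne_zero x).hasFDerivAt (hg.differentiable one_ne_zero x).hasFDerivAt
  rw [pd]
  erw [h.fderiv]
  simp [pd, add_comm]

/-- Put `D_j = ∂_j W`, a function of `x_j` alone, so that `W = -∑ ∂_j D_j`. For `j ≠ b`, `∂_j D_j ×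
D_b = ∂_j (D_j × D_b)` integrates to zero. For `j = b` the product is `e_b` pointwise, by `sin² +
cos² = 1`. -/
lemma integral_abc_cross (b : Fin 3) :
    ∫ x in cell, crossL (cplxC3 (abcField x)) (cplxC3 (pd b abcField x))
      = -(cellVol : ℂ) • EuclideanSpace.single b 1 := by
  have hc : ContDiff ℝ ∞ abcField := contDiff_trig _ _
  have hp : IsPeriodic abcField := periodic_trig _ _
  let D : Fin 3 → E3 → C3 := fun i x => cplxC3 (pd i abcField x)
  have hD : ∀ i, ContDiff ℝ ∞ (D i) := fun i => cplxCLM.contDiff.comp (contDiff_pd hc i)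
  have hDp : ∀ i, IsPeriodic (D i) := fun i j x => by simp only [D, hp.pd i j x]
  have hpd : ∀ i j x, pd j (D i) x = cplxC3 (pd j (pd i abcField) x) := fun i j x =>
    congrFun (pd_cplx (contDiff_pd hc i) j) x
  have hoff : ∀ i j x, j ≠ i → pd j (D i) x = 0 := by
    intro i j x hij
    rw [hpd]
    simp only [abcField, pd_trig]
    ext m
    simp [trig, Pi.single_apply, hij, cplxC3, cplx]
  have hW : ∀ x, cplxC3 (abcField x) = -∑ j, pd j (D j) x := by
    intro x
    simp only [hpd, ← cplxCLM_apply, ← map_sum, ← map_neg]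
    exact congrArg _ (congrFun abcField_eq x)
  have hdiag : ∀ x, crossL (pd b (D b) x) (D b x) = EuclideanSpace.single b 1 := by
    intro x
    rw [hpd]
    simp only [D, abcField, pd_trig]
    have hs : ∀ j, Complex.sin (x j) * Complex.sin (x j) +
        Complex.cos (x j) * Complex.cos (x j) = 1 := fun j => by
      rw [← sq, ← sq, Complex.sin_sq_add_cos_sq]
    ext m
    fin_cases b <;> fin_cases m <;>
      simp [trig, Fin.sum_univ_three, crossL_apply, cross_apply, cplxC3, cplx, hs]
  have hcr : ∀ j, ContDiff ℝ 1 fun x => crossL (D j x) (D b x) := fun j =>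
    ((crossL.bilinearRestrictScalars ℝ).isBoundedBilinearMap.contDiff.comp
      ((hD j).prodMk (hD b))).of_le (by simp)
  have hexp : ∀ x, crossL (cplxC3 (abcField x)) (cplxC3 (pd b abcField x))
      = -∑ j, (if j = b then EuclideanSpace.single b 1
        else pd j (fun x => crossL (D j x) (D b x)) x) := by
    intro x
    rw [hW, map_neg, neg_apply, map_sum, _root_.sum_apply]
    congr 1
    refine Finset.sum_congr rfl fun j _ => ?_
    split_ifs with hj
    · subst hj; exact hdiag x
    · rw [pd_crossL ((hD j).of_le (by simp)) ((hD b).of_le (by simp)), hoff b j x hj, map_zero,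
        add_zero]
  simp only [hexp]
  rw [integral_neg, integral_finsetSum]
  · have hj : ∀ j, ∫ x in cell, (if j = b then EuclideanSpace.single b (1 : ℂ)
        else pd j (fun x => crossL (D j x) (D b x)) x)
        = if j = b then (cellVol : ℂ) • EuclideanSpace.single b (1 : ℂ) else 0 := by
      intro j
      split_ifs with h
      · rw [integral_const, measureReal_restrict_apply_univ]
        ext m
        simp [cellVol]
      · exact integral_pd_eq_zero (hcr j) (fun i x => by simp only [hDp j i x, hDp b i x]) j
    simp only [hj]
    simp
  · intro j _
    split_ifs with h
    · exact integrable_const _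
    · exact integrable_cell (continuous_pd (hcr j) j)

lemma fc_abc_divergence (k : Fin 3 → ℤ) :
    ∑ a, (k a : ℂ) * fc (fun x => cplxC3 (abcField x)) k a = 0 := by
  have h1 : ContDiff ℝ 1 fun x => cplxC3 (abcField x) := abc.contDiff_cplx.of_le (by simp)
  have hd : ∀ a, fc (fun x => pd a (fun x => cplxC3 (abcField x)) x a) k
      = (Complex.I * k a) * fc (fun x => cplxC3 (abcField x)) k a := by
    intro a
    rw [← fc_comp_C3 (integrable_cell (continuous_pd h1 a)), fc_pd h1 abc.periodic_cplx]
    rfl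
  have hs : fc (fun x => ∑ a, pd a (fun x => cplxC3 (abcField x)) x a) k = 0 := by
    have : ∀ x, ∑ a, pd a (fun x => cplxC3 (abcField x)) x a = 0 := by
      intro x
      have h2 : divergence abcField x = 0 := abc.2.2.2.2 x
      have h3 : ∀ a, pd a (fun x => cplxC3 (abcField x)) x a = ((pd a abcField x a : ℝ) : ℂ) :=
        fun a => by rw [pd_cplx (f := abcField) (contDiff_trig _ _)]; rfl
      simp only [h3]
      rw [← Complex.ofReal_sum]
      exact_mod_cast h2
    simp only [this, fc, smul_zero, integral_zero]
  rw [fc_finset_sum] at hs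
  · simp only [hd, mul_assoc, ← Finset.mul_sum] at hs
    exact (mul_eq_zero.1 hs).resolve_left Complex.I_ne_zero
  · exact fun a _ => integrable_cell
      ((EuclideanSpace.proj a : C3 →L[ℂ] ℂ).continuous.comp (continuous_pd h1 a))

lemma fc_abc_laplacian (k : Fin 3 → ℤ) :
    (∑ a, (k a : ℂ) ^ 2) • fc (fun x => cplxC3 (abcField x)) k
      = fc (fun x => cplxC3 (abcField x)) k := by
  have h := abc.contDiff_cplx
  have hpd2 : ∀ a, fc (pd a (pd a fun x => cplxC3 (abcField x))) k
      = -((k a : ℂ) ^ 2) • fc (fun x => cplxC3 (abcField x)) k := by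
    intro a
    refine ((fc_pd_iterate h abc.periodic_cplx a 2 k).2).trans ?_
    congr 1
    rw [mul_pow, Complex.I_sq]
    ring
  have hc : ContDiff ℝ ∞ abcField := contDiff_trig _ _
  have hcc : ContDiff ℝ ∞ fun x => cplxC3 (abcField x) := h
  have hpd : ∀ a x, pd a (pd a fun x => cplxC3 (abcField x)) x
      = cplxCLM (pd a (pd a abcField) x) := by
    intro a x
    rw [pd_cplx hc, pd_cplx (contDiff_pd hc a)]
    rfl
  have hint : ∀ a, Integrable (pd a (pd a fun x => cplxC3 (abcField x)))
      (volume.restrict cell) := fun a =>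
    integrable_cell (ContDiff.pd_infty (ContDiff.pd_infty hcc a) a).continuous
  have e : (fun x => cplxC3 (abcField x))
      = fun x => (-ContinuousLinearMap.id ℂ C3)
        (∑ a, pd a (pd a fun x => cplxC3 (abcField x)) x) := by
    funext x
    simp only [hpd, ← map_sum, neg_apply, ContinuousLinearMap.id_apply]
    rw [← map_neg]
    exact congrArg cplxCLM (congrFun abcField_eq x)
  have h3 := fc_clm (-ContinuousLinearMap.id ℂ C3)
    (f := fun x => ∑ a, pd a (pd a fun x => cplxC3 (abcField x)) x)
    (integrable_finsetSum _ fun a _ => hint a) k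
  rw [← e, fc_finset_sum _ _ (fun a _ => hint a)] at h3
  simp only [hpd2, ← Finset.sum_smul, neg_apply, ContinuousLinearMap.id_apply,
    Finset.sum_neg_distrib, neg_smul, neg_neg] at h3
  exact h3.symm

/-- For divergence-free `W`, `curl (W × e_b) = ∂_b W`, and `(-Δ)⁻¹` fixes it because `-ΔW = W`. On
coefficients this is `k × (w × e_b) = k_b w - (k · w) e_b`. -/
lemma curlInv_abc (b : Fin 3) :
    curlInv (mult abc.linf (constField (EuclideanSpace.single b 1)))
      = (memLp_cell (f := fun x => cplxC3 (pd b abcField x))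
        (continuous_cplxC3.comp (contDiff_pd abc.contDiff b).continuous) 2).toLp _ := by
  have h1 : ContDiff ℝ 1 fun x => cplxC3 (abcField x) := abc.contDiff_cplx.of_le (by simp)
  refine L2Torus.ext_fc fun k => ?_
  rw [fc_curlInv, fc_congr_ae (mult_constField_coe abc _), fc_congr_ae (MemLp.coeFn_toLp _),
    show (fun x => cplxC3 (pd b abcField x)) = pd b fun x => cplxC3 (abcField x) from
      (pd_cplx abc.contDiff b).symm, fc_pd h1 abc.periodic_cplx]
  have e : fc (fun x => crossL (cplxC3 (abc.field x)) (EuclideanSpace.single b 1)) k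
      = crossL (fc (fun x => cplxC3 (abcField x)) k) (EuclideanSpace.single b 1) :=
    fc_clm (crossL.flip (EuclideanSpace.single b 1)) (integrable_cell h1.continuous) k
  rw [e]
  have hdiv := fc_abc_divergence k
  have hlap := fc_abc_laplacian k
  generalize fc (fun x => cplxC3 (abcField x)) k = w at *
  by_cases hw : w = 0
  · subst hw; simp
  -- The relation `|k|² w = w` places nonzero coefficients on the unit sphere.
  have hs : (∑ a, (k a : ℂ) ^ 2) = 1 := by
    by_contra hne
    have : ((∑ a, (k a : ℂ) ^ 2) - 1) • w = 0 := by rw [sub_smul, hlap, one_smul, sub_self]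
    exact (smul_ne_zero (sub_ne_zero.2 hne) hw) this
  rw [hs, div_one]
  rw [Fin.sum_univ_three] at hdiv
  ext m
  fin_cases b <;> fin_cases m <;> simp [crossL_apply, cross_apply, kvec] <;>
    first | linear_combination (-Complex.I) * hdiv | ring

/-- The second-order response of the ABC field is `-1`. -/
theorem matOf_quadResp_abc : matOf (quadResp abc.linf abc.linf) = -1 := by
  ext a b
  have h1 : matOf (quadResp abc.linf abc.linf) a b = avgL (mult abc.linf
    (curlInv (mult abc.linf (constField (EuclideanSpace.single b 1))))) a := rfl
  rw [h1, curlInv_abc, avgL_apply]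
  have h2 : ∫ x in cell, mult abc.linf ((memLp_cell (f := fun x => cplxC3 (pd b abcField x))
        (continuous_cplxC3.comp (contDiff_pd abc.contDiff b).continuous) 2).toLp _) x
      = ∫ x in cell, crossL (cplxC3 (abcField x)) (cplxC3 (pd b abcField x)) := by
    refine integral_congr_ae ?_
    filter_upwards [mult_coe abc.linf ((memLp_cell (f := fun x => cplxC3 (pd b abcField x))
        (continuous_cplxC3.comp (contDiff_pd abc.contDiff b).continuous) 2).toLp _),
      abc.linf_coe, (memLp_cell (f := fun x => cplxC3 (pd b abcField x))
        (continuous_cplxC3.comp (contDiff_pd abc.contDiff b).continuous) 2).coeFn_toLp]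
      with x h1 h2 h3
    rw [h1, h2, h3]
    rfl
  rw [h2, integral_abc_cross]
  have hV : ((cellVol : ℝ) : ℂ) ≠ 0 := by exact_mod_cast cellVol_pos.ne'
  by_cases hab : a = b
  · subst hab; simp [hV]
  · simp [hab]

/-! ### Openness and density -/

/-- If `det C ≠ 0` then `A + t B + t² C` is nonsingular for all small `t ≠ 0`. -/
theorem eventually_det_ne_zero (A B C : Matrix (Fin 3) (Fin 3) ℂ) (hC : C.det ≠ 0) :
    ∀ᶠ t : ℝ in nhdsWithin 0 {0}ᶜ, (A + (t : ℂ) • B + (t : ℂ) ^ 2 • C).det ≠ 0 := by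
  let Q : Matrix (Fin 3) (Fin 3) (Polynomial ℂ) := A.map Polynomial.C
    + (Polynomial.X : Polynomial ℂ) • B.map Polynomial.C
    + (Polynomial.X ^ 2 : Polynomial ℂ) • C.map Polynomial.C
  have heval : ∀ t : ℂ, Q.det.eval t = (A + t • B + t ^ 2 • C).det := by
    intro t
    rw [← Polynomial.coe_evalRingHom, RingHom.map_det]
    congr 1
    ext a b
    simp [Q]
    ring
  have hQ : Q.det ≠ 0 := by
    -- Substituting `t = 1 / s` and clearing denominators reveals `C` at `s = 0`, so the determinant
    -- polynomial cannot vanish identically.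
    have hc : Continuous fun s : ℂ => (s ^ 2 • A + s • B + C).det := by fun_prop
    have h0 : ∀ᶠ s in nhds (0 : ℂ), (s ^ 2 • A + s • B + C).det ≠ 0 := by
      refine hc.continuousAt.eventually_ne ?_
      simpa using hC
    obtain ⟨s, hs, hs0⟩ := ((h0.filter_mono nhdsWithin_le_nhds).and
      (self_mem_nhdsWithin (s := ({0}ᶜ : Set ℂ)))).exists
    have hs0' : s ≠ 0 := hs0
    intro h
    have h1 := heval s⁻¹
    rw [h, Polynomial.eval_zero] at h1
    have h2 : s ^ 2 • A + s • B + C = s ^ 2 • (A + s⁻¹ • B + s⁻¹ ^ 2 • C) := by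
      rw [smul_add, smul_add, smul_smul, smul_smul]
      congr 2
      · congr 2; field_simp
      · rw [← mul_pow, mul_inv_cancel₀ hs0', one_pow, one_smul]
    rw [h2, Matrix.det_smul, ← h1, mul_zero] at hs
    exact hs rfl
  have hfin : {t : ℝ | Q.det.eval (t : ℂ) = 0}.Finite := by
    have : {z : ℂ | Q.det.eval z = 0}.Finite := by
      refine Q.det.roots.toFinset.finite_toSet.subset fun z hz => ?_
      simpa [hQ] using hz
    exact this.preimage Complex.ofReal_injective.injOn
  -- The determinant may vanish at `t = 0`; the other zeros are finitely many and stay away from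
  -- `0`.
  have hcl : IsClosed ({t : ℝ | Q.det.eval (t : ℂ) = 0} \ {0}) := (hfin.subset sdiff_subset).isClosed
  have hmem := hcl.isOpen_compl.mem_nhds (show (0 : ℝ) ∈ _ by simp)
  filter_upwards [nhdsWithin_le_nhds hmem, self_mem_nhdsWithin] with t ht ht0
  rw [← heval]
  exact fun h => ht ⟨h, ht0⟩

lemma alphaUnstable_iff (U : HDiv) : AlphaUnstable U ↔
    (⨆ x, ‖fderiv ℝ U.field x‖ₑ) < 1 ∧ IsUnit (1 - cellOp U.linf) ∧
      ∃ j : E3, j ≠ 0 ∧ SimpleUnstable (alphaMat U.linf U.linf j) := by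
  constructor
  · rintro ⟨h1, j, hj, A, hA, hp⟩
    obtain ⟨hu, rfl⟩ := (isAlphaMatrix_iff U j A).1 hA
    exact ⟨h1, hu, j, hj, hp⟩
  · rintro ⟨h1, hu, j, hj, hp⟩
    exact ⟨h1, j, hj, _, (isAlphaMatrix_iff U j _).2 ⟨hu, rfl⟩, hp⟩

lemma isOpen_isUnit_cellOp :
    IsOpen {u : Lp C3 ⊤ (volume.restrict cell) | IsUnit (1 - cellOp u)} :=
  Units.isOpen.preimage (continuous_const.sub continuous_cellOp)

/-- The same `j` serves all nearby fields; for fixed `j` the gradient bound, invertibility and the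
spectral condition are each stable. -/
lemma isOpen_alphaUnstable : IsOpen {U : HDiv | AlphaUnstable U} := by
  rw [isOpen_iff_mem_nhds]
  intro U hU
  obtain ⟨h1, hu, j, hj, hp⟩ := (alphaUnstable_iff U).1 hU
  have hc := continuous_linf.continuousAt (x := U)
  have e1 := isOpen_gradient_lt.mem_nhds h1
  have e2 := hc.eventually (isOpen_isUnit_cellOp.mem_nhds hu)
  have e3 := ((continuousAt_alphaMat (u := U.linf) hu j).comp
    (f := fun V : HDiv => (V.linf, V.linf)) (hc.prodMk hc)).eventually
    (isOpen_simpleUnstable.mem_nhds hp)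
  filter_upwards [e1, e2, e3] with V h1 h2 h3
  exact (alphaUnstable_iff V).2 ⟨h1, h2, j, hj, h3⟩

theorem isOpen_Omega : IsOpen Omega := by
  have : Omega = ⋃ δ : {δ : ℝ // 0 < δ}, (fun U : HDiv => δ.1 • U) ⁻¹' {U | AlphaUnstable U} := by
    ext U
    simp [Omega]
  rw [this]
  exact isOpen_iUnion fun δ => isOpen_alphaUnstable.preimage (continuous_const_smul_HDiv δ.1)

/-- A field with nonsingular second-order response is in `Ω`. -/
theorem mem_Omega_of_det_ne_zero {U : HDiv} (h : (matOf (quadResp U.linf U.linf)).det ≠ 0) :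
    U ∈ Omega := by
  obtain ⟨M, hM, hUM⟩ := exists_real_symm U
  have hdet : M.det ≠ 0 := by
    intro h0
    apply h
    have := RingHom.map_det Complex.ofRealHom M
    rw [h0, map_zero] at this
    rw [hUM]
    exact this.symm
  obtain ⟨j, hj, hS⟩ := exists_simpleUnstable hM hdet
  -- The unstable matrix is now `alphaMat 0 U.linf j`, the limit of the rescaled alpha-matrices.
  rw [← hUM, ← respOp_zero] at hS
  have h0 : cellOp 0 = 0 := by simp [cellOp]
  have hu0 : IsUnit (1 - cellOp 0) := by simp [h0]
  have hlim : Filter.Tendsto (fun δ : ℝ => δ • U) (nhds 0) (nhds 0) := by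
    simpa using tendsto_add_smul 0 U
  have hz : (0 : HDiv).linf = 0 := by
    have := HDiv.linf_smul 0 (0 : HDiv)
    simpa using this
  have hlin : Filter.Tendsto (fun δ : ℝ => (δ • U).linf) (nhds 0) (nhds 0) := by
    have := (continuous_linf.tendsto 0).comp hlim
    rwa [hz] at this
  have hgrad : (⨆ x, ‖fderiv ℝ (0 : HDiv).field x‖ₑ) < 1 := by
    have : ∀ x, fderiv ℝ (0 : HDiv).field x = 0 := fun x => by
      change fderiv ℝ (fun _ : E3 => (0 : E3)) x = 0
      exact fderiv_const_apply 0
    refine lt_of_le_of_lt (iSup_le (a := 0) fun x => ?_) one_pos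
    rw [this x, ← ofReal_norm, norm_zero, ENNReal.ofReal_zero]
  have e1 := hlim.eventually (isOpen_gradient_lt.mem_nhds hgrad)
  have e2 := hlin.eventually (isOpen_isUnit_cellOp.mem_nhds hu0)
  have e3 : ∀ᶠ δ : ℝ in nhds 0, SimpleUnstable (alphaMat (δ • U).linf U.linf j) := by
    have hc : Filter.Tendsto (fun δ : ℝ => ((δ • U).linf, U.linf)) (nhds 0)
        (nhds (0, U.linf)) := hlin.prodMk_nhds tendsto_const_nhds
    exact ((continuousAt_alphaMat (u := U.linf) hu0 j).tendsto.comp hc).eventually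
      (isOpen_simpleUnstable.mem_nhds hS)
  obtain ⟨δ, ⟨h1, h2, h3⟩, hδ⟩ := (((e1.and (e2.and e3)).filter_mono nhdsWithin_le_nhds).and
    (self_mem_nhdsWithin (s := Ioi (0 : ℝ)))).exists
  refine ⟨δ, hδ, (alphaUnstable_iff _).2 ⟨h1, h2, j, hj, ?_⟩⟩
  -- Pulling out the positive factor `δ²` restores the true alpha-matrix of `δ • U` without
  -- affecting instability.
  have hδ' : (0 : ℝ) < δ := hδ
  have e : alphaMat (δ • U).linf (δ • U).linf j
      = ((δ ^ 2 : ℝ) : ℂ) • alphaMat (δ • U).linf U.linf j := by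
    conv_lhs => rw [HDiv.linf_smul δ U, alphaMat_smul_right, ← HDiv.linf_smul]
    push_cast
    rfl
  rw [e]
  exact h3.smul (by positivity)

/-- Perturb along the ABC field: the second-order response of `U + t • abc` is quadratic in `t` with
leading coefficient `-1`, hence nonsingular for all small `t ≠ 0`. -/
theorem dense_Omega : Dense Omega := by
  intro U
  rw [mem_closure_iff_nhds]
  intro O hO
  have e1 := ((tendsto_add_smul U abc).eventually hO).filter_mono
    (nhdsWithin_le_nhds (s := {0}ᶜ))
  have e2 := eventually_det_ne_zero (matOf (quadResp U.linf U.linf))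
    (matOf (quadResp U.linf abc.linf) + matOf (quadResp abc.linf U.linf))
    (matOf (quadResp abc.linf abc.linf)) (by
      rw [matOf_quadResp_abc, Matrix.det_neg]; simp)
  obtain ⟨t, h1, h2⟩ := (e1.and e2).exists
  refine ⟨U + t • abc, h1, mem_Omega_of_det_ne_zero ?_⟩
  rwa [HDiv.linf_add, HDiv.linf_smul, matOf_quadResp_add_smul]

end AlphaDynamo

theorem mainTheorem4 :
    IsOpen AlphaDynamo.Omega ∧ Dense AlphaDynamo.Omega :=
  ⟨AlphaDynamo.isOpen_Omega, AlphaDynamo.dense_Omega⟩
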